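/- Let $m\ge 1$ and let $N=(n_1,\ldots,n_m)$ be positive integers with $N\neq(1,\ldots,1)$. Put $|N|=n_1+\cdots+n_m$, let $l$ be the number of indices $j$ with $n_j=1$, and let $$\Omega_N=\Big\{Z=(Z_1,\ldots,Z_m)\in\mathbb C^{n_1}\times\cdots\times\mathbb C^{n_m}:\ \sum_{j=1}^m\big(|Z_j|^2+|Z_j\bullet Z_j|\big)<1\Big\},\qquad z\bullet w=\sum_k z_kw_k,\quad |z|=\sqrt{z\bullet\bar z}.$$ Let $K=3m$ if $N=(2,\ldots,2)$ and $K=|N|+m-l+1$ otherwise. Let $2K<p\le\infty$ and $\alpha=\frac12-\frac Kp$ (so $\alpha=\frac12$ if $p=\infty$). Theorem 1.2. There is a $\bar\partial$-closed $(0,1)$-form $f$ with coefficients in $C^\infty(\Omega_N)$ such that the coefficients of $f$ lie in $L^s(\Omega_N)$ for every $s<p$ if $p<\infty$, and in $L^\infty(\Omega_N)$ if $p=\infty$, and such that, whenever a locally integrable function $u$ on $\Omega_N$ satisfies $\bar\partial u=f$ in the sense of distributions, $u\notin\Lambda_{\alpha+\varepsilon}(\Omega_N)$ for every $\varepsilon>0$.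 Moreover $f$ can be chosen of the form $f=\bar\partial u_0$ with $u_0\in C^\infty(\Omega_N)$. Here $\Lambda_\beta(\Omega_N)$, $\beta>0$, is the classical Lipschitz space: writing $\beta=k+\gamma$ with $k\in\mathbb N_0$ and $0<\gamma\le1$, it consists of the functions of class $C^k$ on $\Omega_N$ with bounded derivatives of order at most $k$ such that every derivative $g$ of order $k$ satisfies, for some constant $C$, $|g(Z+h)-g(Z)|\le C|h|^\gamma$ whenever $Z,Z+h\in\Omega_N$ (if $\gamma<1$), or $|g(Z+h)+g(Z-h)-2g(Z)|\le C|h|$ whenever $Z,Z\pm h\in\Omega_N$ (if $\gamma=1$). -/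

import Mathlib

open MeasureTheory
open scoped ContDiff

noncomputable section

namespace DbarSharp

/-- The space `ℂ^{n_1} × ⋯ × ℂ^{n_m}` for `N = (n_1, …, n_m)`, with coordinates `Z ⟨j, k⟩`
(the `k`-th coordinate of the `j`-th block `Z_j`). Its measure `volume` is Lebesgue measure.
Since the norm of a function type is the sup norm, the Euclidean length is defined
separately below. -/
abbrev Space {m : ℕ} (N : Fin m → ℕ) : Type := (Σ j : Fin m, Fin (N j)) → ℂ

/-- The bilinear product `z • w = ∑ z_k w_k`. -/
def bullet {κ : Type} [Fintype κ] (z w : κ → ℂ) : ℂ := ∑ k, z k * w k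

/-- The Euclidean length `|z| = (∑ |z_k|²)^{1/2}`. -/
def euclid {κ : Type} [Fintype κ] (z : κ → ℂ) : ℝ := Real.sqrt (∑ k, ‖z k‖ ^ 2)

/-- The `j`-th block `Z_j ∈ ℂ^{n_j}` of a point `Z`. -/
def block {m : ℕ} {N : Fin m → ℕ} (Z : Space N) (j : Fin m) : Fin (N j) → ℂ :=
  fun k => Z ⟨j, k⟩

/-- The domain `Ω_N = {Z : ∑_j (|Z_j|² + |Z_j • Z_j|) < 1}`. -/
def Omega {m : ℕ} (N : Fin m → ℕ) : Set (Space N) :=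
  {Z | ∑ j, (euclid (block Z j) ^ 2 + ‖bullet (block Z j) (block Z j)‖) < 1}

/-- The number of indices `j` with `n_j = 1`. -/
def numOnes {m : ℕ} (N : Fin m → ℕ) : ℕ := (Finset.univ.filter fun j => N j = 1).card

open Classical in
/-- The number `K` with `α(N,p) = 1/2 - K/p`: it is `3m` if `N = (2, …, 2)` and
`|N| + m - l + 1` otherwise, where `l = numOnes N ≤ m`. -/
def critical {m : ℕ} (N : Fin m → ℕ) : ℕ :=
  if ∀ j, N j = 2 then 3 * m else (∑ j, N j) + (m - numOnes N) + 1

/-- The exponent `α(N,p) = 1/2 - K/p`, which is `1/2` for `p = ∞`. -/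
def alpha {m : ℕ} (N : Fin m → ℕ) (p : ENNReal) : ℝ :=
  1 / 2 - (critical N : ℝ) * (p⁻¹).toReal

/-- The Wirtinger derivative `∂g/∂z̄_i = (∂g/∂x_i + √-1 ∂g/∂y_i) / 2`, where
`z_i = x_i + √-1 y_i`. -/
def dbar {ι : Type} [Fintype ι] [DecidableEq ι] (i : ι) (g : (ι → ℂ) → ℂ) (Z : ι → ℂ) : ℂ :=
  (1 / 2) * (fderiv ℝ g Z (Pi.single i 1) + Complex.I * fderiv ℝ g Z (Pi.single i Complex.I))

/-- The smooth form `∑ f_i dz̄_i` is `∂̄`-closed on `U`. -/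
def IsDbarClosed {ι : Type} [Fintype ι] [DecidableEq ι] (U : Set (ι → ℂ))
    (f : ι → (ι → ℂ) → ℂ) : Prop :=
  ∀ i k, ∀ Z ∈ U, dbar k (f i) Z = dbar i (f k) Z

/-- `u` is a locally integrable function on the open set `U` with `∂̄u = ∑ f_i dz̄_i` in the
sense of distributions on `U`. -/
def IsDbarSolution {ι : Type} [Fintype ι] [DecidableEq ι] (U : Set (ι → ℂ))
    (f : ι → (ι → ℂ) → ℂ) (u : (ι → ℂ) → ℂ) : Prop :=
  LocallyIntegrableOn u U volume ∧
    ∀ i, ∀ φ : (ι → ℂ) → ℂ, ContDiff ℝ ∞ φ → HasCompactSupport φ → tsupport φ ⊆ U →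
      ∫ Z in U, u Z * dbar i φ Z = - ∫ Z in U, f i Z * φ Z

/-- The seminorm condition of order `γ ∈ (0, 1]`: the Hölder condition of exponent `γ` if
`γ < 1`, and the Zygmund condition on second differences if `γ = 1`. -/
def DiffCondition {ι : Type} [Fintype ι] {F : Type} [NormedAddCommGroup F]
    (U : Set (ι → ℂ)) (γ : ℝ) (g : (ι → ℂ) → F) : Prop :=
  (γ < 1 → ∃ C : ℝ, ∀ Z h, Z ∈ U → Z + h ∈ U → ‖g (Z + h) - g Z‖ ≤ C * euclid h ^ γ) ∧
  (γ = 1 → ∃ C : ℝ, ∀ Z h, Z ∈ U → Z + h ∈ U → Z - h ∈ U →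
    ‖(g (Z + h) - g Z) + (g (Z - h) - g Z)‖ ≤ C * euclid h)

/-- The classical Lipschitz space `Λ_β(U)`, `β > 0`. Write `β = k + γ` with `k ∈ ℕ` and
`0 < γ ≤ 1` (in a unique way). Then `u ∈ Λ_β(U)` if `u` is of class `C^k` with bounded
derivatives of order at most `k`, and those of order `k` satisfy the condition of order `γ`.
For `β < 1` these are the bounded `β`-Hölder functions, `Λ_1` is the Zygmund class. -/
def MemLipschitz {ι : Type} [Fintype ι] (U : Set (ι → ℂ)) (β : ℝ) (u : (ι → ℂ) → ℂ) : Prop :=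
  ∃ (k : ℕ) (γ : ℝ), β = k + γ ∧ 0 < γ ∧ γ ≤ 1 ∧
    ContDiffOn ℝ k u U ∧
    (∀ j ≤ k, ∃ C : ℝ, ∀ Z ∈ U, ‖iteratedFDeriv ℝ j u Z‖ ≤ C) ∧
    DiffCondition U γ (iteratedFDeriv ℝ k u)

end DbarSharp

end

/-! The datum is `f = G ^ c dz̄_{i₀}`, where `G` is holomorphic with positive real part on the
domain and vanishes at a boundary point `Z₀`, and `c = -K/p + √-1`. Since `G ^ c` is holomorphic, `f
= ∂̄(conj(z_{i₀}) G ^ c)` is smooth and closed. Two properties of `G` decide everything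
(`exists_sharp_form`).

Size: if `{|G| ≤ δ}` has volume `O(δ^K)`, then `|G|^{-Ks/p}` is integrable for `s < p`
(`lintegral_rpow_neg_lt_top`), which gives the `L^s` bounds.

Rigidity: suppose that near `(1 - t) Z₀` the domain contains discs of radius of order `√t` in a
complex direction `e`, thickened by order `t` in all directions, on which `G` is close to `t`
(`IsModelPoint`). Test the equation with a bump rescaled to such sets at heights `(τ-1)δ`, `τδ`,
`(τ+1)δ`, and take second differences. Integration by parts along `e` gains a factor `√δ`, so the
side of `f` has size `√δ · δ^{-K/p}`. The side of `u` is at most of order `δ^γ` by Lipschitz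
regularity in the radial direction. If `γ > 1/2 - K/p`, letting `δ → 0` gives a contradiction
(`IsModelPoint.not_memLipschitz`). The summand `√-1` in `c` keeps the second difference of `t ^ c`
nonzero even when `K/p = 0`.

In almost all cases `G` is `peak N`, affine in the isotropic coordinates `w_j = z₀ - √-1 z₁` (`2z₀`
on a line). Completing squares (`two_mul_re_peak`) shows that its real part is positive and controls
every coordinate, whence the volume bound. A direction `e` exists if some `n_j ≥ 3` or if `m ≥ 2`.
For `N = (2)` the block function is `(|w| + |v|)² / 2` with `v = z₀ + √-1 z₁`; it has a corner at `v
= 0`, so there is no such direction, and `peakTwo` is used at a smooth boundary point instead. -/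

namespace DbarSharp

/-! ### Anisotropic dilations and change of variables -/

section Dilation

variable {ι : Type}

/-- The anisotropic dilation of `ℂ^ι` by the factor `r` along `e` and by the factor `s` on the
hyperplane `Y i₀ = 0`, provided that `e i₀ = 1`. -/
noncomputable def dilation (e : ι → ℂ) (i₀ : ι) (r s : ℝ) : (ι → ℂ) →L[ℝ] (ι → ℂ) :=
  s • ContinuousLinearMap.id ℝ (ι → ℂ) + (r - s) •
    (ContinuousLinearMap.restrictScalars ℝ
      ((ContinuousLinearMap.proj (R := ℂ) (φ := fun _ : ι => ℂ) i₀).smulRight e))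

lemma dilation_apply (e : ι → ℂ) (i₀ : ι) (r s : ℝ) (Y : ι → ℂ) :
    dilation e i₀ r s Y = (s : ℂ) • Y + (((r - s : ℝ) : ℂ) * Y i₀) • e := by
  ext i
  simp [dilation]
  ring

lemma dilation_comp {e : ι → ℂ} {i₀ : ι} (he : e i₀ = 1) (r s r' s' : ℝ) (Y : ι → ℂ) :
    dilation e i₀ r s (dilation e i₀ r' s' Y) = dilation e i₀ (r * r') (s * s') Y := by
  ext i
  simp [dilation_apply, he]
  ring

lemma dilation_one (e : ι → ℂ) (i₀ : ι) (Y : ι → ℂ) : dilation e i₀ 1 1 Y = Y := by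
  ext i
  simp [dilation_apply]

/-- The anisotropic dilation as a continuous linear equivalence. -/
noncomputable def dilationEquiv {e : ι → ℂ} {i₀ : ι} (he : e i₀ = 1) {r s : ℝ} (hr : r ≠ 0) (hs : s ≠ 0) :
    (ι → ℂ) ≃L[ℝ] (ι → ℂ) :=
  ContinuousLinearEquiv.equivOfInverse (dilation e i₀ r s) (dilation e i₀ r⁻¹ s⁻¹)
    (fun Y => by rw [dilation_comp he, inv_mul_cancel₀ hr, inv_mul_cancel₀ hs, dilation_one])
    (fun Y => by rw [dilation_comp he, mul_inv_cancel₀ hr, mul_inv_cancel₀ hs, dilation_one])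

lemma dilationEquiv_symm_smul {e : ι → ℂ} {i₀ : ι} (he : e i₀ = 1) {r s : ℝ} (hr : r ≠ 0)
    (hs : s ≠ 0) (a : ℂ) :
    (dilationEquiv he hr hs).symm (a • e) = r⁻¹ • (a • e) := by
  change dilation e i₀ r⁻¹ s⁻¹ (a • e) = _
  ext i
  simp [dilation_apply, he]
  ring

variable [Fintype ι]

/-- A linear change of variables multiplies all integrals by the same constant. -/
lemma exists_integral_comp_equiv (D : (ι → ℂ) ≃L[ℝ] (ι → ℂ)) :
    ∃ c : ℝ, c ≠ 0 ∧ ∀ g : (ι → ℂ) → ℂ, ∀ X, ∫ Y, g (X + D Y) = c * ∫ Z, g Z := by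
  have hdet : LinearMap.det (D : (ι → ℂ) →ₗ[ℝ] (ι → ℂ)) ≠ 0 := D.toLinearEquiv.isUnit_det'.ne_zero
  have hmap := Measure.map_linearMap_addHaar_eq_smul_addHaar (volume : Measure (ι → ℂ)) hdet
  refine ⟨|(LinearMap.det (D : (ι → ℂ) →ₗ[ℝ] (ι → ℂ)))⁻¹|, by simpa using hdet, fun g X => ?_⟩
  have h1 : ∫ Y, g (X + D Y) = ∫ Z, g (X + Z) ∂(Measure.map D volume) :=
    (D.toHomeomorph.measurableEmbedding.integral_map (fun Z => g (X + Z))).symm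
  have h2 : Measure.map D (volume : Measure (ι → ℂ)) =
    ENNReal.ofReal |(LinearMap.det (D : (ι → ℂ) →ₗ[ℝ] (ι → ℂ)))⁻¹| • volume := hmap
  rw [h1, h2, integral_smul_measure, integral_add_left_eq_self, ENNReal.toReal_ofReal (abs_nonneg _)]
  simp

lemma integrable_comp_equiv (D : (ι → ℂ) ≃L[ℝ] (ι → ℂ)) {g : (ι → ℂ) → ℂ} (hg : Integrable g)
    (X : ι → ℂ) : Integrable fun Y => g (X + D Y) := by
  have hdet : LinearMap.det (D : (ι → ℂ) →ₗ[ℝ] (ι → ℂ)) ≠ 0 := D.toLinearEquiv.isUnit_det'.ne_zero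
  have hmap := Measure.map_linearMap_addHaar_eq_smul_addHaar (volume : Measure (ι → ℂ)) hdet
  have h2 : Measure.map D (volume : Measure (ι → ℂ)) =
    ENNReal.ofReal |(LinearMap.det (D : (ι → ℂ) →ₗ[ℝ] (ι → ℂ)))⁻¹| • volume := hmap
  have h3 : Integrable (fun Z => g (X + Z)) (Measure.map D volume) := by
    rw [h2]
    exact (hg.comp_add_left X).smul_measure ENNReal.ofReal_ne_top
  exact (D.toHomeomorph.measurableEmbedding.integrable_map_iff).1 h3

end Dilation

/-! ### Testing the weak equation in one complex direction -/

section WeakSolution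

variable {ι : Type}

/-- The derivative `∂φ/∂ζ̄` of `ζ ↦ φ (Z + ζ e)` at `ζ = 0`. -/
noncomputable def dbarDir (e : ι → ℂ) (φ : (ι → ℂ) → ℂ) (Z : ι → ℂ) : ℂ :=
  (1 / 2) * (fderiv ℝ φ Z e + Complex.I * fderiv ℝ φ Z (Complex.I • e))

lemma tsupport_dbarDir_subset (e : ι → ℂ) (φ : (ι → ℂ) → ℂ) :
    tsupport (dbarDir e φ) ⊆ tsupport φ := by
  refine closure_minimal (fun Z hZ => ?_) (isClosed_tsupport φ)
  by_contra h
  have h0 : fderiv ℝ φ Z = 0 := by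
    have h1 : Z ∉ tsupport (fderiv ℝ φ) := fun h2 => h (tsupport_fderiv_subset ℝ h2)
    exact image_eq_zero_of_notMem_tsupport h1
  exact hZ (by simp [dbarDir, h0])

variable [Fintype ι]

lemma integrableOn_mul_of_tsupport_subset {U : Set (ι → ℂ)} {u g : (ι → ℂ) → ℂ}
    (hu : LocallyIntegrableOn u U volume) (hg : Continuous g) (hgc : HasCompactSupport g)
    (hgU : tsupport g ⊆ U) : Integrable fun Z => u Z * g Z := by
  have h1 : IntegrableOn u (tsupport g) := hu.integrableOn_compact_subset hgU hgc
  have h2 : IntegrableOn (fun Z => u Z * g Z) (tsupport g) :=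
    h1.mul_continuousOn hg.continuousOn hgc
  refine (integrableOn_iff_integrable_of_support_subset ?_).1 h2
  intro Z hZ
  apply subset_tsupport
  intro h0
  exact hZ (by simp [h0])

lemma continuous_dbarDir {e : ι → ℂ} {φ : (ι → ℂ) → ℂ} (hφ : ContDiff ℝ ∞ φ) :
    Continuous (dbarDir e φ) := by
  have := hφ.continuous_fderiv (by simp)
  unfold dbarDir
  fun_prop

variable [DecidableEq ι]

/-- This is the chain rule: `ζ ↦ Z + ζ e` is holomorphic, so only the conjugates of the `e i`
appear. With `e i₀ = 1`, a form having only a `dz̄_{i₀}` component is then tested with coefficient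
one. -/
lemma dbarDir_eq_sum (e : ι → ℂ) (φ : (ι → ℂ) → ℂ) (Z : ι → ℂ) :
    dbarDir e φ Z = ∑ i, starRingEnd ℂ (e i) * dbar i φ Z := by
  set L := fderiv ℝ φ Z
  have key (v : ι → ℂ) : L v = ∑ i, (((v i).re : ℂ) * L (Pi.single i 1) +
      ((v i).im : ℂ) * L (Pi.single i Complex.I)) := by
    have hv : v = ∑ i, ((v i).re • (Pi.single i 1 : ι → ℂ) +
        (v i).im • (Pi.single i Complex.I : ι → ℂ)) := by
      ext k
      rw [Finset.sum_apply, Finset.sum_eq_single k]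
      · simp
      · intro b _ hb
        simp [hb.symm]
      · simp
    conv_lhs => rw [hv]
    simp
  have h : dbarDir e φ Z = (1 / 2) * (L e + Complex.I * L (Complex.I • e)) := rfl
  rw [h, key e, key (Complex.I • e), Finset.mul_sum, ← Finset.sum_add_distrib, Finset.mul_sum]
  refine Finset.sum_congr rfl fun i _ => ?_
  have hc : starRingEnd ℂ (e i) = ((e i).re : ℂ) - (e i).im * Complex.I := by
    apply Complex.ext <;> simp
  have hd : dbar i φ Z = (1 / 2) * (L (Pi.single i 1) + Complex.I * L (Pi.single i Complex.I)) := rfl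
  rw [hc, hd]
  simp only [Pi.smul_apply, smul_eq_mul, Complex.mul_re, Complex.mul_im, Complex.I_re, Complex.I_im]
  push_cast
  linear_combination ((1/2) * (e i).im * L (Pi.single i Complex.I)) * Complex.I_sq

lemma dbar_eq_dbarDir (i : ι) (φ : (ι → ℂ) → ℂ) : dbar i φ = dbarDir (Pi.single i 1) φ := by
  ext Z
  have : Complex.I • (Pi.single i 1 : ι → ℂ) = Pi.single i Complex.I := by
    rw [← Pi.single_smul]; simp
  simp [dbar, dbarDir, this]

/-- Testing the equation `∂̄u = F dz̄_{i₀}` in a direction `e` with `e i₀ = 1`. -/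
lemma IsDbarSolution.integral_dbarDir {U : Set (ι → ℂ)} {F u : (ι → ℂ) → ℂ} {i₀ : ι}
    (hu : IsDbarSolution U (fun i Z => if i = i₀ then F Z else 0) u)
    {e : ι → ℂ} (he : e i₀ = 1) {φ : (ι → ℂ) → ℂ} (hφ : ContDiff ℝ ∞ φ)
    (hφc : HasCompactSupport φ) (hφU : tsupport φ ⊆ U) :
    ∫ Z, u Z * dbarDir e φ Z = - ∫ Z, F Z * φ Z := by
  have hset (g h : (ι → ℂ) → ℂ) (hh : tsupport h ⊆ tsupport φ) :
      ∫ Z in U, g Z * h Z = ∫ Z, g Z * h Z := by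
    refine setIntegral_eq_integral_of_forall_compl_eq_zero fun Z hZ => ?_
    rw [image_eq_zero_of_notMem_tsupport fun h' => hZ (hφU (hh h')), mul_zero]
  have hd (i : ι) : tsupport (dbar i φ) ⊆ tsupport φ := by
    rw [dbar_eq_dbarDir]; exact tsupport_dbarDir_subset _ _
  have hcd (i : ι) : Continuous (dbar i φ) := by
    rw [dbar_eq_dbarDir]; exact continuous_dbarDir hφ
  have hint (i : ι) : Integrable fun Z => u Z * dbar i φ Z :=
    integrableOn_mul_of_tsupport_subset hu.1 (hcd i)
      (hφc.mono' ((subset_tsupport _).trans (hd i))) ((hd i).trans hφU)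
  have heq (i : ι) : ∫ Z, u Z * dbar i φ Z =
      - (if i = i₀ then ∫ Z, F Z * φ Z else 0) := by
    rw [← hset _ _ (hd i), hu.2 i φ hφ hφc hφU]
    split_ifs with h
    · rw [← hset _ _ subset_rfl]
      simp [h]
    · simp [h]
  have h1 : (fun Z => u Z * dbarDir e φ Z) =
      fun Z => ∑ i, starRingEnd ℂ (e i) * (u Z * dbar i φ Z) := by
    ext Z
    rw [dbarDir_eq_sum, Finset.mul_sum]
    exact Finset.sum_congr rfl fun i _ => by ring
  rw [h1, integral_finsetSum _ fun i _ => (hint i).const_mul _]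
  simp_rw [integral_const_mul, heq]
  simp [he]

/-- The rescaled form of the equation `∂̄u = F dz̄_{i₀}`, tested with `ψ`. -/
lemma IsDbarSolution.integral_comp_dilation {U : Set (ι → ℂ)} {F u : (ι → ℂ) → ℂ} {i₀ : ι}
    (hu : IsDbarSolution U (fun i Z => if i = i₀ then F Z else 0) u)
    {e : ι → ℂ} (he : e i₀ = 1) {ψ : (ι → ℂ) → ℂ} (hψ : ContDiff ℝ ∞ ψ)
    (hψc : HasCompactSupport ψ) {r s : ℝ} (hr : r ≠ 0) (hs : s ≠ 0) (X : ι → ℂ)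
    (hU : ∀ Y ∈ tsupport ψ, X + dilation e i₀ r s Y ∈ U) (hF : LocallyIntegrableOn F U volume) :
    Integrable (fun Y => F (X + dilation e i₀ r s Y) * ψ Y) ∧
    Integrable (fun Y => u (X + dilation e i₀ r s Y) * dbarDir e ψ Y) ∧
    ∫ Y, u (X + dilation e i₀ r s Y) * dbarDir e ψ Y =
      - (r * ∫ Y, F (X + dilation e i₀ r s Y) * ψ Y) := by
  set D := dilationEquiv he hr hs with hD
  have hDap (Y) : D Y = dilation e i₀ r s Y := rfl
  simp_rw [← hDap] at hU ⊢
  set φ : (ι → ℂ) → ℂ := fun Z => ψ (D.symm (Z - X)) with hφ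
  have hφs : ContDiff ℝ ∞ φ :=
    hψ.comp (D.symm.contDiff.comp (contDiff_id.sub contDiff_const))
  set T : (ι → ℂ) ≃ₜ (ι → ℂ) := (Homeomorph.addRight (-X)).trans D.symm.toHomeomorph with hT
  have hTap (Z) : T Z = D.symm (Z - X) := by simp [hT, sub_eq_add_neg]
  have hφT : φ = ψ ∘ T := by ext Z; simp [hφ, hTap]
  have hφc : HasCompactSupport φ := by
    rw [hφT]; exact hψc.comp_homeomorph T
  have hφU : tsupport φ ⊆ U := by
    intro Z hZ
    have h1 : T Z ∈ tsupport ψ := by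
      rw [hφT] at hZ
      exact tsupport_comp_subset_preimage ψ T.continuous hZ
    have h2 := hU _ h1
    rwa [hTap, D.apply_symm_apply, add_sub_cancel] at h2
  -- `D⁻¹` divides both `e` and `√-1 e` by `r`, so only the factor along `e` enters; the Jacobian is
  -- common to both integrals and drops out.
  have hder (Y : ι → ℂ) : dbarDir e φ (X + D Y) = (r : ℂ)⁻¹ * dbarDir e ψ Y := by
    have h1 : HasFDerivAt φ ((fderiv ℝ ψ Y).comp (D.symm : (ι → ℂ) →L[ℝ] (ι → ℂ))) (X + D Y) := by
      have h2 : HasFDerivAt ψ (fderiv ℝ ψ Y) (D.symm (X + D Y - X)) := by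
        have : D.symm (X + D Y - X) = Y := by simp
        rw [this]
        exact (hψ.differentiable (by simp) Y).hasFDerivAt
      have h3 : HasFDerivAt (fun Z => D.symm (Z - X)) (D.symm : (ι → ℂ) →L[ℝ] (ι → ℂ))
          (X + D Y) := by
        have := (D.symm.hasFDerivAt (x := X + D Y - X)).comp (X + D Y)
          ((hasFDerivAt_id (𝕜 := ℝ) (X + D Y)).sub_const X)
        simpa using this
      exact h2.comp (X + D Y) h3
    have hs1 : D.symm e = r⁻¹ • e := by
      simpa using dilationEquiv_symm_smul he hr hs 1
    have hs2 : D.symm (Complex.I • e) = r⁻¹ • (Complex.I • e) :=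
      dilationEquiv_symm_smul he hr hs Complex.I
    simp only [dbarDir, h1.fderiv, ContinuousLinearMap.comp_apply,
      ContinuousLinearEquiv.coe_coe, hs1, hs2, map_smul, Complex.real_smul]
    push_cast
    ring
  have hφψ (Y : ι → ℂ) : φ (X + D Y) = ψ Y := by simp [hφ]
  have hrC : (r : ℂ) ≠ 0 := by exact_mod_cast hr
  obtain ⟨c, hc, hcv⟩ := exists_integral_comp_equiv D
  have hds := tsupport_dbarDir_subset e φ
  have hi : Integrable fun Z => u Z * dbarDir e φ Z :=
    integrableOn_mul_of_tsupport_subset hu.1 (continuous_dbarDir hφs)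
      (hφc.mono' ((subset_tsupport _).trans hds)) (hds.trans hφU)
  have hi2 := integrable_comp_equiv D hi X
  have he1 : (fun Y => u (X + D Y) * dbarDir e ψ Y) =
      fun Y => (r : ℂ) * (u (X + D Y) * dbarDir e φ (X + D Y)) := by
    ext Y
    rw [hder]
    field_simp
  have he2 : (fun Y => F (X + D Y) * ψ Y) = fun Y => F (X + D Y) * φ (X + D Y) := by
    ext Y; rw [hφψ]
  refine ⟨?_, by rw [he1]; exact hi2.const_mul _, ?_⟩
  · rw [he2]
    exact integrable_comp_equiv D
      (integrableOn_mul_of_tsupport_subset hF hφs.continuous hφc hφU) X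
  rw [he1, he2, integral_const_mul, hcv (fun Z => u Z * dbarDir e φ Z) X,
    hcv (fun Z => F Z * φ Z) X, hu.integral_dbarDir he hφs hφc hφU]
  ring

end WeakSolution

/-! ### Second differences of Lipschitz functions -/

section Lipschitz

variable {ι : Type} [Fintype ι]

lemma norm_le_euclid (h : ι → ℂ) : ‖h‖ ≤ euclid h := by
  refine (pi_norm_le_iff_of_nonneg (Real.sqrt_nonneg _)).2 fun i => Real.le_sqrt_of_sq_le ?_
  exact Finset.single_le_sum (f := fun k => ‖h k‖ ^ 2) (fun k _ => by positivity)
    (Finset.mem_univ i)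

lemma euclid_nonneg (h : ι → ℂ) : 0 ≤ euclid h := Real.sqrt_nonneg _

lemma euclid_neg (h : ι → ℂ) : euclid (-h) = euclid h := by simp [euclid]

lemma euclid_smul {δ : ℝ} (hδ : 0 ≤ δ) (h : ι → ℂ) : euclid (δ • h) = δ * euclid h := by
  simp only [euclid, Pi.smul_apply, norm_smul, mul_pow, ← Finset.mul_sum]
  rw [Real.sqrt_mul (by positivity), Real.sqrt_sq (norm_nonneg _), Real.norm_of_nonneg hδ]

/-- Every function in a Lipschitz space of order larger than `α < 1` satisfies a bound of order
larger than `α` on its second differences. -/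
lemma MemLipschitz.exists_second_difference_le {U : Set (ι → ℂ)} (hU : IsOpen U) {α β : ℝ}
    (hα : α < 1) (hαβ : α < β) {u : (ι → ℂ) → ℂ} (hu : MemLipschitz U β u) :
    ∃ C γ : ℝ, 0 ≤ C ∧ α < γ ∧ ∀ X h, (∀ s ∈ Set.Icc (-1 : ℝ) 1, X + s • h ∈ U) →
      ‖(u (X + h) - u X) + (u (X - h) - u X)‖ ≤ C * euclid h ^ γ := by
  obtain ⟨k, γ, hβ, hγ0, hγ1, hreg, hbd, hdiff⟩ := hu
  have hpts {X h : ι → ℂ} (hs : ∀ s ∈ Set.Icc (-1 : ℝ) 1, X + s • h ∈ U) :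
      X ∈ U ∧ X + h ∈ U ∧ X - h ∈ U := by
    refine ⟨by simpa using hs 0 (by norm_num), by simpa using hs 1 (by norm_num), ?_⟩
    simpa [sub_eq_add_neg] using hs (-1) (by norm_num)
  rcases Nat.eq_zero_or_pos k with rfl | hk
  · have hαγ : α < γ := by simpa [hβ] using hαβ
    have hnorm (X Y : ι → ℂ) :
        ‖iteratedFDeriv ℝ 0 u X - iteratedFDeriv ℝ 0 u Y‖ = ‖u X - u Y‖ := by
      rw [iteratedFDeriv_zero_eq_comp]
      simp only [Function.comp_apply, ← map_sub, LinearIsometryEquiv.norm_map]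
    rcases hγ1.lt_or_eq with h1 | h1
    · obtain ⟨C, hC⟩ := hdiff.1 h1
      refine ⟨|C| + |C|, γ, by positivity, hαγ, fun X h hs => ?_⟩
      obtain ⟨hX, hp, hm⟩ := hpts hs
      have e1 := hC X h hX hp
      have e2 := hC X (-h) hX (by rwa [← sub_eq_add_neg])
      rw [hnorm] at e1 e2
      rw [euclid_neg, ← sub_eq_add_neg] at e2
      have hpow := Real.rpow_nonneg (euclid_nonneg h) γ
      have := mul_le_mul_of_nonneg_right (le_abs_self C) hpow
      linarith [norm_add_le (u (X + h) - u X) (u (X - h) - u X)]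
    · obtain ⟨C, hC⟩ := hdiff.2 h1
      refine ⟨|C|, γ, by positivity, hαγ, fun X h hs => ?_⟩
      obtain ⟨hX, hp, hm⟩ := hpts hs
      have e1 := hC X h hX hp hm
      rw [iteratedFDeriv_zero_eq_comp] at e1
      simp only [Function.comp_apply, ← map_sub, ← map_add, LinearIsometryEquiv.norm_map] at e1
      rw [h1, Real.rpow_one]
      exact e1.trans (mul_le_mul_of_nonneg_right (le_abs_self C) (euclid_nonneg h))
  · obtain ⟨C, hC⟩ := hbd 1 hk
    simp_rw [norm_iteratedFDeriv_one] at hC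
    have hlip {X h : ι → ℂ} (hs : ∀ s ∈ Set.Icc (0 : ℝ) 1, X + s • h ∈ U) :
        ‖u (X + h) - u X‖ ≤ |C| * euclid h := by
      have hseg : segment ℝ X (X + h) ⊆ U := by
        rw [segment_eq_image']
        rintro _ ⟨s, hs', rfl⟩
        simpa using hs s hs'
      have := (convex_segment X (X + h)).norm_image_sub_le_of_norm_fderiv_le (𝕜 := ℝ) (f := u)
        (C := |C|)
        (fun Z hZ => ((hreg.differentiableOn (by exact_mod_cast hk.ne')) Z
          (hseg hZ)).differentiableAt (hU.mem_nhds (hseg hZ)))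
        (fun Z hZ => (hC Z (hseg hZ)).trans (le_abs_self C))
        (left_mem_segment ℝ X (X + h)) (right_mem_segment ℝ X (X + h))
      refine this.trans ?_
      rw [add_sub_cancel_left]
      exact mul_le_mul_of_nonneg_left (norm_le_euclid h) (abs_nonneg C)
    -- For `k ≥ 1` the bounded gradient is used only to get order `1`, which suffices because `α <
    -- 1`.
    refine ⟨|C| + |C|, 1, by positivity, hα, fun X h hs => ?_⟩
    have e1 := hlip (X := X) (h := h) fun s hs' => hs s ⟨by linarith [hs'.1], hs'.2⟩
    have e2 := hlip (X := X) (h := -h) fun s hs' => by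
      simpa using hs (-s) ⟨by linarith [hs'.2], by linarith [hs'.1]⟩
    rw [euclid_neg, ← sub_eq_add_neg] at e2
    rw [Real.rpow_one]
    linarith [norm_add_le (u (X + h) - u X) (u (X - h) - u X)]

end Lipschitz

/-! ### Complex powers of positive numbers -/

section Powers

/-- A positive factor does not change the argument, so the principal logarithm is additive here.
This homogeneity extracts `δ ^ c` from `G ^ c` after rescaling. -/
lemma ofReal_mul_cpow {δ : ℝ} (hδ : 0 < δ) {c : ℂ} (hc : c ≠ 0) (z : ℂ) :
    ((δ : ℂ) * z) ^ c = (δ : ℂ) ^ c * z ^ c := by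
  have hδ' : (δ : ℂ) ≠ 0 := by exact_mod_cast hδ.ne'
  rcases eq_or_ne z 0 with rfl | hz
  · simp [hc]
  · rw [Complex.cpow_def_of_ne_zero (mul_ne_zero hδ' hz), Complex.cpow_def_of_ne_zero hδ',
      Complex.cpow_def_of_ne_zero hz, Complex.log_ofReal_mul hδ hz, ← Complex.exp_add,
      Complex.ofReal_log hδ.le]
    ring_nf

/-- The value `2` is excluded by `|2 ^ c| ≤ 1`. The value `1` would make `c log 2` a multiple of
`2π√-1`, whereas its imaginary part `log 2` lies strictly between `0` and `1`. -/
lemma two_cpow_ne {c : ℂ} (hre : c.re ≤ 0) (him : c.im = 1) : (2 : ℂ) ^ c ≠ 1 ∧ (2 : ℂ) ^ c ≠ 2 := by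
  have hn : ‖(2 : ℂ) ^ c‖ = (2 : ℝ) ^ c.re := by
    simpa using Complex.norm_cpow_eq_rpow_re_of_pos (two_pos) c
  have hle : (2 : ℝ) ^ c.re ≤ 1 := Real.rpow_le_one_of_one_le_of_nonpos (by norm_num) hre
  refine ⟨fun h => ?_, fun h => ?_⟩
  · rw [Complex.cpow_def_of_ne_zero two_ne_zero, Complex.exp_eq_one_iff] at h
    obtain ⟨n, hn⟩ := h
    have hlog : Complex.log 2 = ((Real.log 2 : ℝ) : ℂ) := by
      rw [Complex.ofReal_log (by norm_num)]; norm_num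
    have h2 := congrArg Complex.im hn
    have hr : ((n : ℂ) * (2 * Real.pi * Complex.I)).im = n * (2 * Real.pi) := by simp
    rw [hlog, Complex.im_ofReal_mul, him, hr, mul_one] at h2
    have hl0 : 0 < Real.log 2 := Real.log_pos (by norm_num)
    have hl1 : Real.log 2 < 1 := by linarith [Real.log_two_lt_d9]
    rw [h2] at hl0 hl1
    have hpi := Real.pi_gt_three
    have n0 : 0 < n := by
      by_contra hneg
      have : (n : ℝ) ≤ 0 := by exact_mod_cast not_lt.1 hneg
      nlinarith
    have : (1 : ℝ) ≤ n := by exact_mod_cast n0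
    nlinarith
  · rw [h] at hn
    norm_num at hn
    linarith

/-- The power function `t ↦ t ^ c` is not affine on `{1, 2, 3, 4}`. -/
lemma exists_second_difference_cpow_ne_zero {c : ℂ} (hre : c.re ≤ 0) (him : c.im = 1) :
    ∃ τ : ℝ, 2 ≤ τ ∧ τ ≤ 3 ∧
      (((τ - 1 : ℝ) : ℂ) ^ c + ((τ + 1 : ℝ) : ℂ) ^ c - 2 * (τ : ℂ) ^ c ≠ 0) := by
  by_contra! H
  have h2 := H 2 (by norm_num) (by norm_num)
  have h3 := H 3 (by norm_num) (by norm_num)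
  have hc : c ≠ 0 := fun h => by simp [h] at him
  have h4 : (4 : ℂ) ^ c = (2 : ℂ) ^ c * (2 : ℂ) ^ c := by
    have := ofReal_mul_cpow (δ := 2) (by norm_num) hc 2
    norm_num at this
    exact this
  norm_num at h2 h3
  obtain ⟨n1, n2⟩ := two_cpow_ne hre him
  -- Eliminating `3 ^ c` from the vanishing second differences at `τ = 2` and `τ = 3` leaves `x² -
  -- 3x + 2 = 0` for `x = 2 ^ c`.
  have : ((2 : ℂ) ^ c - 1) * ((2 : ℂ) ^ c - 2) = 0 := by
    linear_combination 2 * h2 + h3 - h4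
  rcases mul_eq_zero.1 this with h | h
  · exact n1 (sub_eq_zero.1 h)
  · exact n2 (sub_eq_zero.1 h)

lemma exists_norm_cpow_sub_le {c : ℂ} {τ : ℝ} (hτ : 0 < τ) {ε : ℝ} (hε : 0 < ε) :
    ∃ ρ > 0, ∀ x : ℂ, ‖x‖ ≤ ρ → ‖((τ : ℂ) + x) ^ c - (τ : ℂ) ^ c‖ ≤ ε := by
  have hcont : ContinuousAt (fun x : ℂ => ((τ : ℂ) + x) ^ c) 0 := by
    refine ContinuousAt.cpow (by fun_prop) continuousAt_const ?_
    left
    simpa using hτ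
  obtain ⟨ρ, hρ, h⟩ := Metric.continuousAt_iff.1 hcont ε hε
  refine ⟨ρ / 2, by positivity, fun x hx => ?_⟩
  have := h (x := x) (by rw [dist_zero_right]; linarith)
  rw [dist_eq_norm] at this
  simpa using this.le

end Powers

/-! ### Model boundary points and the obstruction to regularity -/

section Model

variable {ι : Type} [Fintype ι]

/-- Near the boundary point `Z₀` of `U`, the set `U` contains discs of radius `∼ √t` in the
direction `e` around the points `(1 - t) Z₀`, on which the function `G` is close to `t`. -/
def IsModelPoint (U : Set (ι → ℂ)) (G : (ι → ℂ) → ℂ) (Z₀ e : ι → ℂ) : Prop :=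
  ∃ C η₀ : ℝ, 0 ≤ C ∧ 0 < η₀ ∧ ∀ t : ℝ, 0 < t → t ≤ η₀ → ∀ (ζ : ℂ) (Y : ι → ℂ),
    ‖ζ‖ ^ 2 ≤ η₀ * t → ‖Y‖ ≤ η₀ * t →
      (1 - t) • Z₀ + (Y + ζ • e) ∈ U ∧
      ‖G ((1 - t) • Z₀ + (Y + ζ • e)) - t‖ ≤ C * (t ^ 2 + ‖ζ‖ ^ 2 + ‖Y‖)

lemma integral_second_difference {f₁ f₂ f₃ g : (ι → ℂ) → ℂ}
    (h₁ : Integrable fun Y => f₁ Y * g Y) (h₂ : Integrable fun Y => f₂ Y * g Y)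
    (h₃ : Integrable fun Y => f₃ Y * g Y) :
    ∫ Y, (f₁ Y + f₂ Y - 2 * f₃ Y) * g Y =
      (∫ Y, f₁ Y * g Y) + (∫ Y, f₂ Y * g Y) - 2 * ∫ Y, f₃ Y * g Y := by
  have h₁₂ : Integrable fun Y => f₁ Y * g Y + f₂ Y * g Y := h₁.add h₂
  rw [← integral_add h₁ h₂, ← integral_const_mul, ← integral_sub h₁₂ (h₃.const_mul 2)]
  congr 1
  ext Y
  ring

/-- The points of the dilated unit polydisc around `(1 - τδ) Z₀`. -/
lemma IsModelPoint.exists_dilation {U : Set (ι → ℂ)} {G : (ι → ℂ) → ℂ} {Z₀ e : ι → ℂ}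
    (h : IsModelPoint U G Z₀ e) (i₀ : ι) {ρ : ℝ} (hρ : 0 < ρ) :
    ∃ η δ₀ : ℝ, 0 < η ∧ 0 < δ₀ ∧ ∀ δ : ℝ, 0 < δ → δ ≤ δ₀ → ∀ τ : ℝ, 1 ≤ τ → τ ≤ 4 →
      ∀ Y : ι → ℂ, ‖Y‖ ≤ 1 →
        (1 - τ * δ) • Z₀ + dilation e i₀ (η * √δ) (η * δ) Y ∈ U ∧
        ∃ x : ℂ, ‖x‖ ≤ ρ ∧
          G ((1 - τ * δ) • Z₀ + dilation e i₀ (η * √δ) (η * δ) Y) = δ * (τ + x) := by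
  obtain ⟨C, η₀, hC, hη₀, H⟩ := h
  -- Each of the three error terms `t²`, `‖ζ‖²`, `‖Y‖` of the model estimate will be at most `ηδ`,
  -- hence the factor `3`.
  obtain ⟨η, hη, hη1, hηη₀, hηρ⟩ : ∃ η : ℝ, 0 < η ∧ η ≤ 1 ∧ η ≤ η₀ ∧ 3 * C * η ≤ ρ := by
    refine ⟨min (min 1 η₀) (ρ / (3 * C + 1)), by positivity,
      (min_le_left _ _).trans (min_le_left _ _), (min_le_left _ _).trans (min_le_right _ _), ?_⟩
    have h1 : min (min 1 η₀) (ρ / (3 * C + 1)) ≤ ρ / (3 * C + 1) := min_le_right _ _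
    calc 3 * C * min (min 1 η₀) (ρ / (3 * C + 1)) ≤ (3 * C + 1) * (ρ / (3 * C + 1)) := by
          apply mul_le_mul (by linarith) h1 (by positivity) (by positivity)
      _ = ρ := by field_simp
  -- As `τ ≤ 4`, the bound `η₀ / 4` keeps the height `τδ` below `η₀`, and `η / 16` gives `(τδ)² ≤
  -- ηδ`.
  refine ⟨η, min (min 1 (η₀ / 4)) (η / 16), hη, by positivity, fun δ hδ hδ₀ τ h1 h4 Y hY => ?_⟩
  have hδ1 : δ ≤ 1 := hδ₀.trans ((min_le_left _ _).trans (min_le_left _ _))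
  have hδ2 : δ ≤ η₀ / 4 := hδ₀.trans ((min_le_left _ _).trans (min_le_right _ _))
  have hδ3 : δ ≤ η / 16 := hδ₀.trans (min_le_right _ _)
  have hsq : √δ ^ 2 = δ := Real.sq_sqrt hδ.le
  have hsδ : δ ≤ √δ := Real.le_sqrt_of_sq_le (by nlinarith)
  have hτδ : δ ≤ τ * δ := by nlinarith
  have hτδ4 : τ * δ ≤ 4 * δ := by nlinarith
  have hζ : ‖((η * √δ - η * δ : ℝ) : ℂ) * Y i₀‖ ≤ η * √δ := by
    rw [norm_mul, Complex.norm_real, Real.norm_of_nonneg (by nlinarith)]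
    have : ‖Y i₀‖ ≤ 1 := (norm_le_pi_norm Y i₀).trans hY
    have h5 : η * √δ - η * δ ≤ η * √δ := by nlinarith
    calc _ ≤ (η * √δ - η * δ) * 1 := mul_le_mul_of_nonneg_left this (by nlinarith)
      _ ≤ _ := by linarith
  have hζ2 : ‖((η * √δ - η * δ : ℝ) : ℂ) * Y i₀‖ ^ 2 ≤ η * (η * δ) := by
    calc _ ≤ (η * √δ) ^ 2 := pow_le_pow_left₀ (norm_nonneg _) hζ 2
      _ = η * (η * δ) := by rw [mul_pow, hsq]; ring
  have hY' : ‖((η * δ : ℝ) : ℂ) • Y‖ ≤ η * δ := by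
    rw [norm_smul, Complex.norm_real, Real.norm_of_nonneg (by positivity)]
    exact mul_le_of_le_one_right (by positivity) hY
  have hηδ : η * δ ≤ η₀ * (τ * δ) := mul_le_mul hηη₀ hτδ hδ.le hη₀.le
  obtain ⟨hU, hG⟩ := H (τ * δ) (by positivity) (by linarith) _ _
    (hζ2.trans ((mul_le_of_le_one_left (by positivity) hη1).trans hηδ)) (hY'.trans hηδ)
  rw [← dilation_apply] at hU hG
  refine ⟨hU, (G ((1 - τ * δ) • Z₀ + dilation e i₀ (η * √δ) (η * δ) Y) - (τ * δ : ℝ)) / δ, ?_, ?_⟩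
  · rw [norm_div, Complex.norm_real, Real.norm_of_nonneg hδ.le, div_le_iff₀ hδ]
    refine hG.trans ?_
    have hb : (τ * δ) ^ 2 ≤ η * δ := by
      calc (τ * δ) ^ 2 ≤ (4 * δ) ^ 2 := pow_le_pow_left₀ (by positivity) hτδ4 2
        _ = (16 * δ) * δ := by ring
        _ ≤ η * δ := mul_le_mul_of_nonneg_right (by linarith) hδ.le
    have hb2 : η * (η * δ) ≤ η * δ := mul_le_of_le_one_left (by positivity) hη1
    calc _ ≤ C * (3 * (η * δ)) := mul_le_mul_of_nonneg_left (by linarith) hC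
      _ = 3 * C * η * δ := by ring
      _ ≤ ρ * δ := mul_le_mul_of_nonneg_right hηρ hδ.le
  · have : (δ : ℂ) ≠ 0 := by exact_mod_cast hδ.ne'
    field_simp
    push_cast
    ring

variable [DecidableEq ι]

/-- The equation `∂̄u = G ^ c dz̄_{i₀}` has no solution in a Lipschitz space of order larger
than `1 / 2 + re c`. -/
theorem IsModelPoint.not_memLipschitz {U : Set (ι → ℂ)} (hU : IsOpen U) {G : (ι → ℂ) → ℂ}
    {Z₀ e : ι → ℂ} (hmodel : IsModelPoint U G Z₀ e) {i₀ : ι} (he : e i₀ = 1) {c : ℂ}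
    (hre : c.re ≤ 0) (him : c.im = 1)
    (hF : LocallyIntegrableOn (fun Z => G Z ^ c) U volume) {u : (ι → ℂ) → ℂ}
    (hu : IsDbarSolution U (fun i Z => if i = i₀ then G Z ^ c else 0) u) {β : ℝ}
    (hβ : 1 / 2 + c.re < β) : ¬ MemLipschitz U β u := by
  intro hlip
  obtain ⟨C, γ, hC, hγ, hdiff⟩ := hlip.exists_second_difference_le hU (by linarith) hβ
  have hc : c ≠ 0 := fun h => by simp [h] at him
  obtain ⟨τ, hτ2, hτ3, hP⟩ := exists_second_difference_cpow_ne_zero hre him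
  set P := ((τ - 1 : ℝ) : ℂ) ^ c + ((τ + 1 : ℝ) : ℂ) ^ c - 2 * (τ : ℂ) ^ c
  have hPpos : 0 < ‖P‖ := norm_pos_iff.2 hP
  -- The three errors of size `‖P‖ / 8` enter the second difference with weights `1, 1, 2`, so
  -- together they cost half of `‖P‖`.
  obtain ⟨ρ₁, hρ₁, H₁⟩ := exists_norm_cpow_sub_le (c := c) (τ := τ - 1) (by linarith)
    (ε := ‖P‖ / 8) (by positivity)
  obtain ⟨ρ₂, hρ₂, H₂⟩ := exists_norm_cpow_sub_le (c := c) (τ := τ + 1) (by linarith)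
    (ε := ‖P‖ / 8) (by positivity)
  obtain ⟨ρ₃, hρ₃, H₃⟩ := exists_norm_cpow_sub_le (c := c) (τ := τ) (by linarith)
    (ε := ‖P‖ / 8) (by positivity)
  obtain ⟨η, δ₀, hη, hδ₀, hD⟩ := hmodel.exists_dilation i₀ (ρ := min (min ρ₁ ρ₂) ρ₃) (by positivity)
  let b : ContDiffBump (0 : ι → ℂ) := ⟨1 / 2, 1, by norm_num, by norm_num⟩
  set ψ : (ι → ℂ) → ℂ := fun Y => (b Y : ℂ) with hψ
  have hψs : ContDiff ℝ ∞ ψ := Complex.ofRealCLM.contDiff.comp b.contDiff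
  have htsupp : tsupport ψ ⊆ Metric.closedBall 0 1 := by
    rw [← show b.rOut = 1 from rfl, ← b.tsupport_eq]
    exact closure_mono fun Y hY => by simpa [hψ] using hY
  have hψc : HasCompactSupport ψ :=
    (isCompact_closedBall (0 : ι → ℂ) 1).of_isClosed_subset (isClosed_tsupport _) htsupp
  have hnψ (Y : ι → ℂ) : ‖ψ Y‖ = b Y := by simp [hψ, b.nonneg]
  set A : ℝ := ∫ Y, b Y
  have hA : 0 < A := b.integral_pos
  have hψA : ∫ Y, ψ Y = (A : ℂ) := integral_ofReal
  set B : ℝ := ∫ Y, ‖dbarDir e ψ Y‖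
  have hdc : HasCompactSupport (dbarDir e ψ) :=
    hψc.mono' ((subset_tsupport _).trans (tsupport_dbarDir_subset e ψ))
  have hint_d : Integrable (dbarDir e ψ) :=
    (continuous_dbarDir hψs).integrable_of_hasCompactSupport hdc
  -- The quantitative contradiction: a lower bound of order `√δ δ^{re c}` from the datum against an
  -- upper bound of order `δ ^ γ` from the regularity of `u`.
  have key (δ : ℝ) (hδ : 0 < δ) (hδle : δ ≤ δ₀) :
      (η * √δ) * (δ ^ c.re * (‖P‖ / 2) * A) ≤ C * (δ * euclid Z₀) ^ γ * B := by
    set r := η * √δ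
    have hr : 0 < r := by positivity
    have hs : 0 < η * δ := by positivity
    set X : ℝ → (ι → ℂ) → (ι → ℂ) := fun t Y => (1 - t * δ) • Z₀ + dilation e i₀ r (η * δ) Y with hX
    have hmem (t : ℝ) (h1 : 1 ≤ t) (h4 : t ≤ 4) (Y : ι → ℂ) (hY : Y ∈ tsupport ψ) :
        X t Y ∈ U ∧ ∃ x : ℂ, ‖x‖ ≤ min (min ρ₁ ρ₂) ρ₃ ∧ G (X t Y) = δ * (t + x) :=
      hD δ hδ hδle t h1 h4 Y (by simpa using htsupp hY)
    have hsol (t : ℝ) (h1 : 1 ≤ t) (h4 : t ≤ 4) :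
        Integrable (fun Y => G (X t Y) ^ c * ψ Y) ∧
        Integrable (fun Y => u (X t Y) * dbarDir e ψ Y) ∧
        ∫ Y, u (X t Y) * dbarDir e ψ Y = -(r * ∫ Y, G (X t Y) ^ c * ψ Y) :=
      hu.integral_comp_dilation he hψs hψc hr.ne' hs.ne' ((1 - t * δ) • Z₀)
        (fun Y hY => (hmem t h1 h4 Y hY).1) hF
    obtain ⟨iF₁, iu₁, e₁⟩ := hsol (τ - 1) (by linarith) (by linarith)
    obtain ⟨iF₂, iu₂, e₂⟩ := hsol (τ + 1) (by linarith) (by linarith)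
    obtain ⟨iF₃, iu₃, e₃⟩ := hsol τ (by linarith) (by linarith)
    have hsumu : ∫ Y, ((u (X (τ - 1) Y) - u (X τ Y)) + (u (X (τ + 1) Y) - u (X τ Y))) *
        dbarDir e ψ Y = -(r * ∫ Y, (G (X (τ - 1) Y) ^ c + G (X (τ + 1) Y) ^ c -
          2 * G (X τ Y) ^ c) * ψ Y) := by
      have a1 := integral_second_difference iu₁ iu₂ iu₃
      have a2 := integral_second_difference iF₁ iF₂ iF₃
      have a3 : ∫ Y, ((u (X (τ - 1) Y) - u (X τ Y)) + (u (X (τ + 1) Y) - u (X τ Y))) *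
          dbarDir e ψ Y = ∫ Y, (u (X (τ - 1) Y) + u (X (τ + 1) Y) - 2 * u (X τ Y)) *
            dbarDir e ψ Y := by
        congr 1; ext Y; ring
      rw [a3, a1, a2]
      linear_combination e₁ + e₂ - 2 * e₃
    have hup : ‖∫ Y, ((u (X (τ - 1) Y) - u (X τ Y)) + (u (X (τ + 1) Y) - u (X τ Y))) *
        dbarDir e ψ Y‖ ≤ C * (δ * euclid Z₀) ^ γ * B := by
      rw [← integral_const_mul]
      refine norm_integral_le_of_norm_le (hint_d.norm.const_mul _) (ae_of_all _ fun Y => ?_)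
      by_cases hY : Y ∈ tsupport ψ
      · rw [norm_mul]
        refine mul_le_mul_of_nonneg_right ?_ (norm_nonneg _)
        -- Changing the height is a translation along `Z₀`. For `|s| ≤ 1` the height `τ - s` stays
        -- in `[1, 4]`, so the whole segment lies in `U`.
        have hXs (s : ℝ) : X τ Y + s • (δ • Z₀) = X (τ - s) Y := by
          ext i; simp only [hX, Pi.add_apply, Pi.smul_apply, Complex.real_smul]; push_cast; ring
        have := hdiff (X τ Y) (δ • Z₀) fun s hs => by
          rw [hXs]
          exact (hmem (τ - s) (by linarith [hs.2]) (by linarith [hs.1]) Y hY).1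
        have p1 : X τ Y + δ • Z₀ = X (τ - 1) Y := by simpa using hXs 1
        have p2 : X τ Y - δ • Z₀ = X (τ + 1) Y := by simpa [sub_eq_add_neg] using hXs (-1)
        rwa [p1, p2, euclid_smul hδ.le] at this
      · rw [image_eq_zero_of_notMem_tsupport fun h => hY (tsupport_dbarDir_subset e ψ h)]
        simp
    have hlow : ‖(∫ Y, (G (X (τ - 1) Y) ^ c + G (X (τ + 1) Y) ^ c - 2 * G (X τ Y) ^ c) * ψ Y) -
        (δ : ℂ) ^ c * P * A‖ ≤ δ ^ c.re * (‖P‖ / 2) * A := by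
      rw [← hψA, ← integral_const_mul, ← integral_sub ?_ ?_, ← integral_const_mul]
      · refine norm_integral_le_of_norm_le (b.integrable.const_mul _) (ae_of_all _ fun Y => ?_)
        by_cases hY : Y ∈ tsupport ψ
        · obtain ⟨x₁, hx₁, g₁⟩ := (hmem (τ - 1) (by linarith) (by linarith) Y hY).2
          obtain ⟨x₂, hx₂, g₂⟩ := (hmem (τ + 1) (by linarith) (by linarith) Y hY).2
          obtain ⟨x₃, hx₃, g₃⟩ := (hmem τ (by linarith) (by linarith) Y hY).2
          have n₁ := H₁ x₁ (hx₁.trans ((min_le_left _ _).trans (min_le_left _ _)))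
          have n₂ := H₂ x₂ (hx₂.trans ((min_le_left _ _).trans (min_le_right _ _)))
          have n₃ := H₃ x₃ (hx₃.trans (min_le_right _ _))
          have hid : (G (X (τ - 1) Y) ^ c + G (X (τ + 1) Y) ^ c - 2 * G (X τ Y) ^ c) * ψ Y -
              (δ : ℂ) ^ c * P * ψ Y = (δ : ℂ) ^ c * (((((τ - 1 : ℝ) : ℂ) + x₁) ^ c -
                ((τ - 1 : ℝ) : ℂ) ^ c) + ((((τ + 1 : ℝ) : ℂ) + x₂) ^ c - ((τ + 1 : ℝ) : ℂ) ^ c) -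
                2 * (((τ : ℂ) + x₃) ^ c - (τ : ℂ) ^ c)) * ψ Y := by
            simp only [g₁, g₂, g₃, ofReal_mul_cpow hδ hc, P]
            ring
          rw [hid, norm_mul, norm_mul, hnψ, Complex.norm_cpow_eq_rpow_re_of_pos hδ]
          refine mul_le_mul_of_nonneg_right (mul_le_mul_of_nonneg_left ?_ (by positivity)) b.nonneg
          refine (norm_sub_le _ _).trans ?_
          refine (add_le_add_left (norm_add_le _ _) _).trans ?_
          rw [norm_mul, Complex.norm_two]
          linarith
        · have : ψ Y = 0 := image_eq_zero_of_notMem_tsupport hY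
          rw [this, ← hnψ, this]; simp
      · refine ((iF₁.add iF₂).sub (iF₃.const_mul 2)).congr (ae_of_all _ fun Y => ?_)
        simp only [Pi.add_apply, Pi.sub_apply]; ring
      · exact (hψs.continuous.integrable_of_hasCompactSupport hψc).const_mul _
    rw [hsumu, norm_neg, norm_mul, Complex.norm_real, Real.norm_of_nonneg hr.le] at hup
    refine le_trans (mul_le_mul_of_nonneg_left ?_ hr.le) hup
    have h1 : ‖(δ : ℂ) ^ c * P * A‖ = δ ^ c.re * ‖P‖ * A := by
      rw [norm_mul, norm_mul, Complex.norm_cpow_eq_rpow_re_of_pos hδ, Complex.norm_real,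
        Real.norm_of_nonneg hA.le]
    have h2 := norm_sub_norm_le ((δ : ℂ) ^ c * P * A)
      (∫ Y, (G (X (τ - 1) Y) ^ c + G (X (τ + 1) Y) ^ c - 2 * G (X τ Y) ^ c) * ψ Y)
    rw [norm_sub_rev, h1] at h2
    nlinarith
  have hlim : Filter.Tendsto (fun δ : ℝ => C * euclid Z₀ ^ γ * B * δ ^ (γ - (1 / 2 + c.re)))
      (nhdsWithin 0 (Set.Ioi 0)) (nhds 0) := by
    have h := (Real.continuousAt_rpow_const 0 (γ - (1 / 2 + c.re))
      (Or.inr (by linarith))).tendsto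
    rw [Real.zero_rpow (by linarith)] at h
    simpa using (h.mono_left nhdsWithin_le_nhds).const_mul (C * euclid Z₀ ^ γ * B)
  have hev := hlim.eventually (gt_mem_nhds (show 0 < η * (‖P‖ / 2 * A) by positivity))
  obtain ⟨δ, hlt, hδ, hδle⟩ := (hev.and (Ioc_mem_nhdsGT hδ₀)).exists
  have h := key δ hδ hδle
  rw [Real.mul_rpow hδ.le (euclid_nonneg _)] at h
  -- Dividing `key` by `√δ δ^{re c}` leaves a positive power of `δ` on the right, which tends to
  -- `0`.
  have hsplit : δ ^ γ = δ ^ (γ - (1 / 2 + c.re)) * (√δ * δ ^ c.re) := by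
    rw [Real.sqrt_eq_rpow, ← Real.rpow_add hδ, ← Real.rpow_add hδ]
    congr 1; ring
  rw [hsplit] at h
  have hpos : 0 < √δ * δ ^ c.re := by positivity
  nlinarith [mul_lt_mul_of_pos_right hlt hpos]

end Model

/-! ### Integrability from volumes of sublevel sets -/

section Integrability

/-- If the sublevel sets of `g > 0` have measure `O(δ ^ K)`, then `g ^ (-q)` is integrable for
`q < K`. -/
lemma lintegral_rpow_neg_lt_top {X : Type*} [MeasurableSpace X] {μ : Measure X}
    [IsFiniteMeasure μ] {g : X → ℝ} (hg : Measurable g) (hpos : ∀ᵐ x ∂μ, 0 < g x) {K : ℕ}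
    {C : ENNReal} (hC : C ≠ ⊤) {δ₀ : ℝ} (hδ₀ : 0 < δ₀)
    (hμ : ∀ δ : ℝ, 0 < δ → δ ≤ δ₀ → μ {x | g x ≤ δ} ≤ C * ENNReal.ofReal (δ ^ K))
    {q : ℝ} (hq0 : 0 ≤ q) (hqK : q < K) : ∫⁻ x, ENNReal.ofReal (g x ^ (-q)) ∂μ < ⊤ := by
  set d : ℕ → ℝ := fun n => δ₀ * (1 / 2) ^ n with hd
  have hdpos (n : ℕ) : 0 < d n := by positivity
  have hms (n : ℕ) : MeasurableSet {x | g x ≤ d n} := measurableSet_le hg measurable_const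
  -- Dyadic decomposition: on the shell `d (n + 1) < g ≤ d n` the function is at most `d (n + 1) ^
  -- (-q)`. Integrating over all of `{g ≤ d n}` gives a geometric series of ratio `2^{q - K}`.
  have hbound : ∀ᵐ x ∂μ, ENNReal.ofReal (g x ^ (-q)) ≤ ENNReal.ofReal (δ₀ ^ (-q)) +
      ∑' n : ℕ, {x | g x ≤ d n}.indicator (fun _ => ENNReal.ofReal (d (n + 1) ^ (-q))) x := by
    filter_upwards [hpos] with x hx
    rcases le_total δ₀ (g x) with h | h
    · refine le_add_right (ENNReal.ofReal_le_ofReal ?_)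
      exact Real.rpow_le_rpow_of_nonpos hδ₀ h (by linarith)
    · obtain ⟨n, h1, h2⟩ := exists_nat_pow_near_of_lt_one (x := g x / δ₀) (y := 1 / 2)
        (by positivity) (by rwa [div_le_one hδ₀]) (by norm_num) (by norm_num)
      rw [lt_div_iff₀ hδ₀, mul_comm] at h1
      rw [div_le_iff₀ hδ₀, mul_comm] at h2
      refine le_add_left (le_trans ?_ (ENNReal.le_tsum n))
      rw [Set.indicator_of_mem (by exact h2)]
      exact ENNReal.ofReal_le_ofReal
        (Real.rpow_le_rpow_of_nonpos (hdpos _) h1.le (by linarith))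
  refine (lintegral_mono_ae hbound).trans_lt ?_
  rw [lintegral_add_left measurable_const, lintegral_const,
    lintegral_tsum fun n => (measurable_const.indicator (hms n)).aemeasurable]
  refine ENNReal.add_lt_top.2 ⟨ENNReal.mul_lt_top ENNReal.ofReal_lt_top (measure_lt_top _ _), ?_⟩
  set ρ : ℝ := (1 / 2) ^ ((K : ℝ) - q) with hρ
  have hρ0 : 0 ≤ ρ := by positivity
  have hρ1 : ρ < 1 := Real.rpow_lt_one (by norm_num) (by norm_num) (by linarith)
  set A : ℝ := δ₀ ^ (-q) * δ₀ ^ K * (1 / 2) ^ (-q)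
  have hterm (n : ℕ) : d (n + 1) ^ (-q) * d n ^ K = A * ρ ^ n := by
    have e1 : ((1 / 2 : ℝ) ^ (n + 1)) ^ (-q) = (1 / 2) ^ (-q) * ((1 / 2 : ℝ) ^ (-q)) ^ n := by
      rw [pow_succ', Real.mul_rpow (by norm_num) (by positivity), ← Real.rpow_natCast,
        ← Real.rpow_natCast, ← Real.rpow_mul (by norm_num), ← Real.rpow_mul (by norm_num),
        mul_comm (n : ℝ)]
    have e2 : ρ = (1 / 2 : ℝ) ^ K * (1 / 2) ^ (-q) := by
      rw [hρ, sub_eq_add_neg, Real.rpow_add (by norm_num), Real.rpow_natCast]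
    rw [hd]
    simp only
    rw [Real.mul_rpow hδ₀.le (by positivity), e1, e2, mul_pow, mul_pow, ← pow_mul, ← pow_mul,
      mul_comm n K]
    simp only [A]
    ring
  have hle (n : ℕ) : ∫⁻ x, {x | g x ≤ d n}.indicator
      (fun _ => ENNReal.ofReal (d (n + 1) ^ (-q))) x ∂μ ≤ C * ENNReal.ofReal (A * ρ ^ n) := by
    rw [lintegral_indicator_const (hms n), ← hterm,
      ENNReal.ofReal_mul (Real.rpow_nonneg (hdpos _).le _)]
    have := hμ (d n) (hdpos n) (mul_le_of_le_one_right hδ₀.le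
      (pow_le_one₀ (by norm_num) (by norm_num)))
    calc _ ≤ ENNReal.ofReal (d (n + 1) ^ (-q)) * (C * ENNReal.ofReal (d n ^ K)) := by gcongr
      _ = _ := by ring
  refine (ENNReal.tsum_le_tsum hle).trans_lt ?_
  have hA : 0 ≤ A := by positivity
  rw [ENNReal.tsum_mul_left, ← ENNReal.ofReal_tsum_of_nonneg (fun n => by positivity)
    ((summable_geometric_of_lt_one hρ0 hρ1).mul_left A)]
  exact ENNReal.mul_lt_top hC.lt_top ENNReal.ofReal_lt_top

end Integrability

/-! ### The form attached to a holomorphic function -/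

section Holomorphic

variable {ι : Type} [Fintype ι] [DecidableEq ι]

lemma dbar_eq_zero_of_differentiableAt {g : (ι → ℂ) → ℂ} {Z : ι → ℂ}
    (h : DifferentiableAt ℂ g Z) (i : ι) : dbar i g Z = 0 := by
  rw [dbar_eq_dbarDir, dbarDir, h.fderiv_restrictScalars ℝ]
  simp only [ContinuousLinearMap.coe_restrictScalars', map_smul, smul_eq_mul]
  linear_combination (1 / 2 * fderiv ℂ g Z (Pi.single i 1)) * Complex.I_sq

lemma dbar_mul {g h : (ι → ℂ) → ℂ} {Z : ι → ℂ} (hg : DifferentiableAt ℝ g Z)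
    (hh : DifferentiableAt ℝ h Z) (i : ι) :
    dbar i (fun W => g W * h W) Z = dbar i g Z * h Z + g Z * dbar i h Z := by
  simp only [dbar, fderiv_fun_mul hg hh, add_apply,
    smul_apply, smul_eq_mul]
  ring

lemma dbar_conj_coord (i i₀ : ι) (Z : ι → ℂ) :
    dbar i (fun W => starRingEnd ℂ (W i₀)) Z = if i = i₀ then 1 else 0 := by
  have h : HasFDerivAt (fun W : ι → ℂ => starRingEnd ℂ (W i₀))
      ((Complex.conjCLE : ℂ →L[ℝ] ℂ).comp
        (ContinuousLinearMap.proj (R := ℝ) (φ := fun _ : ι => ℂ) i₀)) Z :=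
    ((Complex.conjCLE : ℂ →L[ℝ] ℂ).comp
        (ContinuousLinearMap.proj (R := ℝ) (φ := fun _ : ι => ℂ) i₀)).hasFDerivAt
  rw [dbar, h.fderiv]
  rcases eq_or_ne i i₀ with rfl | hne
  · simp
    norm_num
  · simp [hne, hne.symm]

/-- A form `∂̄(conj(z_{i₀}) G ^ c)` is an `L^s` datum for `s < p` whose solutions have no better
Lipschitz order than `1 / 2 - K / p`. -/
theorem exists_sharp_form {U : Set (ι → ℂ)} (hU : IsOpen U) (hvol : volume U < ⊤)
    {G : (ι → ℂ) → ℂ} (hG : ContDiff ℂ ∞ G) (hpos : ∀ Z ∈ U, 0 < (G Z).re) {K : ℕ}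
    {C : ENNReal} (hC : C ≠ ⊤) {δ₀ : ℝ} (hδ₀ : 0 < δ₀)
    (hGvol : ∀ δ : ℝ, 0 < δ → δ ≤ δ₀ →
      volume {Z ∈ U | ‖G Z‖ ≤ δ} ≤ C * ENNReal.ofReal (δ ^ K))
    {Z₀ e : ι → ℂ} (hmodel : IsModelPoint U G Z₀ e) {i₀ : ι} (he : e i₀ = 1)
    {p : ENNReal} (hp : p ≠ 0) :
    ∃ f : ι → (ι → ℂ) → ℂ,
      (∀ i, ContDiffOn ℝ ∞ (f i) U) ∧ IsDbarClosed U f ∧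
      (p ≠ ⊤ → ∀ s : ENNReal, s < p → ∀ i, MemLp (f i) s (volume.restrict U)) ∧
      (p = ⊤ → ∀ i, MemLp (f i) ⊤ (volume.restrict U)) ∧
      (∃ u₀ : (ι → ℂ) → ℂ, ContDiffOn ℝ ∞ u₀ U ∧ ∀ i, ∀ Z ∈ U, dbar i u₀ Z = f i Z) ∧
      ∀ u : (ι → ℂ) → ℂ, IsDbarSolution U f u → ∀ ε : ℝ, 0 < ε →
        ¬ MemLipschitz U (1 / 2 - K * (p⁻¹).toReal + ε) u := by
  have : IsFiniteMeasure (volume.restrict U) := ⟨by simpa using hvol⟩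
  set b : ℝ := K * (p⁻¹).toReal with hb
  have hb0 : 0 ≤ b := by positivity
  -- The real part fixes the size of `F`. The imaginary part prevents `F` from being constant when
  -- `b = 0`, in particular for `p = ∞`.
  set c : ℂ := ⟨-b, 1⟩ with hc
  set F : (ι → ℂ) → ℂ := fun Z => G Z ^ c with hF
  have hslit (Z) (hZ : Z ∈ U) : G Z ∈ Complex.slitPlane := Or.inl (hpos Z hZ)
  have hFC : ContDiffOn ℂ ∞ F U := by
    have h1 : ContDiffOn ℂ ∞ (fun Z => Complex.exp (Complex.log (G Z) * c)) U := by
      intro Z hZ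
      exact (((Complex.contDiffAt_log (hslit Z hZ)).comp Z hG.contDiffAt).mul
        contDiffAt_const).cexp.contDiffWithinAt
    refine h1.congr fun Z hZ => ?_
    rw [hF]
    exact Complex.cpow_def_of_ne_zero (Complex.slitPlane_ne_zero (hslit Z hZ)) c
  have hFR : ContDiffOn ℝ ∞ F U := hFC.restrict_scalars ℝ
  have hFd (Z) (hZ : Z ∈ U) : DifferentiableAt ℂ F Z :=
    (hFC.differentiableOn (by simp) Z hZ).differentiableAt (hU.mem_nhds hZ)
  have hFm : AEStronglyMeasurable F (volume.restrict U) :=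
    hFR.continuousOn.aestronglyMeasurable hU.measurableSet
  -- The imaginary part of `c` contributes `exp(-arg G)`, which is at most `exp π`.
  have hFle (Z) (hZ : Z ∈ U) : ‖F Z‖ ≤ Real.exp Real.pi * ‖G Z‖ ^ (-b) := by
    refine (Complex.norm_cpow_le _ _).trans ?_
    rw [div_eq_mul_inv, ← Real.exp_neg, mul_comm]
    refine mul_le_mul_of_nonneg_right (Real.exp_le_exp.2 ?_) (by positivity)
    simp only [hc, mul_one]
    linarith [Complex.neg_pi_lt_arg (G Z)]
  set f : ι → (ι → ℂ) → ℂ := fun i Z => if i = i₀ then F Z else 0 with hf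
  have hfself : f i₀ = F := by ext Z; simp [hf]
  have hfne {i : ι} (hi : i ≠ i₀) : f i = fun _ => 0 := by ext Z; simp [hf, hi]
  have hfdbar (i k : ι) (Z) (hZ : Z ∈ U) : dbar k (f i) Z = 0 := by
    refine dbar_eq_zero_of_differentiableAt ?_ k
    rcases eq_or_ne i i₀ with rfl | hi
    · rw [hfself]; exact hFd Z hZ
    · rw [hfne hi]; exact differentiableAt_const _
  refine ⟨f, fun i => ?_, fun i k Z hZ => by rw [hfdbar i k Z hZ, hfdbar k i Z hZ], ?_, ?_, ?_, ?_⟩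
  · rcases eq_or_ne i i₀ with rfl | hi
    · rwa [hfself]
    · rw [hfne hi]; exact contDiffOn_const
  · intro hptop s hs i
    rcases eq_or_ne i i₀ with rfl | hi
    swap
    · rw [hfne hi]; exact MemLp.zero
    rw [hfself]
    rcases eq_or_ne s 0 with rfl | hs0
    · exact memLp_zero_iff_aestronglyMeasurable.2 hFm
    have hs_top : s ≠ ⊤ := hs.ne_top
    refine ⟨hFm, (eLpNorm_lt_top_iff_lintegral_rpow_enorm_lt_top hs0 hs_top).2 ?_⟩
    have hs' : 0 < s.toReal := ENNReal.toReal_pos hs0 hs_top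
    have hsp : s.toReal < p.toReal := (ENNReal.toReal_lt_toReal hs_top hptop).2 hs
    have hle : ∫⁻ Z in U, ‖F Z‖ₑ ^ s.toReal ≤ ∫⁻ Z in U,
        ENNReal.ofReal (Real.exp Real.pi ^ s.toReal) *
          ENNReal.ofReal (‖G Z‖ ^ (-(b * s.toReal))) := by
      refine setLIntegral_mono' hU.measurableSet fun Z hZ => ?_
      rw [← ENNReal.ofReal_mul (by positivity), ← ofReal_norm,
        ENNReal.ofReal_rpow_of_nonneg (norm_nonneg _) hs'.le]
      refine ENNReal.ofReal_le_ofReal ?_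
      refine (Real.rpow_le_rpow (norm_nonneg _) (hFle Z hZ) hs'.le).trans_eq ?_
      rw [Real.mul_rpow (by positivity) (by positivity), ← Real.rpow_mul (norm_nonneg _), neg_mul]
    refine hle.trans_lt ?_
    rw [lintegral_const_mul' _ _ ENNReal.ofReal_ne_top]
    refine ENNReal.mul_lt_top ENNReal.ofReal_lt_top ?_
    -- The dyadic lemma needs the strict inequality `b s < K`, which fails for `K = 0`; there the
    -- integrand is constant.
    rcases Nat.eq_zero_or_pos K with rfl | hK
    · have : b = 0 := by simp [hb]
      simp [this, hvol]
    refine lintegral_rpow_neg_lt_top (K := K) (g := fun Z => ‖G Z‖) hG.continuous.norm.measurable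
      ?_ hC hδ₀ ?_ (by positivity) ?_
    · filter_upwards [ae_restrict_mem hU.measurableSet] with Z hZ
      exact norm_pos_iff.2 (Complex.slitPlane_ne_zero (hslit Z hZ))
    · intro δ h1 h2
      rw [Measure.restrict_apply (measurableSet_le hG.continuous.norm.measurable measurable_const)]
      refine (measure_mono fun Z hZ => ?_).trans (hGvol δ h1 h2)
      exact ⟨hZ.2, hZ.1⟩
    · rw [hb, ENNReal.toReal_inv, mul_assoc]
      have hp' : 0 < p.toReal := ENNReal.toReal_pos hp hptop
      have : (p.toReal)⁻¹ * s.toReal < 1 := by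
        rw [inv_mul_lt_iff₀ hp']; simpa using hsp
      have hK' : (0 : ℝ) < K := by exact_mod_cast hK
      nlinarith
  · intro hptop i
    rcases eq_or_ne i i₀ with rfl | hi
    swap
    · rw [hfne hi]; exact MemLp.zero
    rw [hfself]
    refine memLp_top_of_bound hFm (Real.exp Real.pi) ?_
    filter_upwards [ae_restrict_mem hU.measurableSet] with Z hZ
    have : b = 0 := by simp [hb, hptop]
    simpa [this] using hFle Z hZ
  · refine ⟨fun Z => starRingEnd ℂ (Z i₀) * F Z, ?_, fun i Z hZ => ?_⟩
    · refine ContDiffOn.mul (ContDiff.contDiffOn ?_) hFR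
      exact Complex.conjCLE.contDiff.comp (contDiff_apply ℝ ℂ i₀)
    · have hconj : DifferentiableAt ℝ (fun W : ι → ℂ => starRingEnd ℂ (W i₀)) Z :=
        (Complex.conjCLE.contDiff.comp (contDiff_apply ℝ ℂ i₀) :
          ContDiff ℝ 1 _).differentiable (by simp) Z
      rw [dbar_mul hconj ((hFd Z hZ).restrictScalars ℝ), dbar_conj_coord,
        dbar_eq_zero_of_differentiableAt (hFd Z hZ), hf]
      simp only [ite_mul, one_mul, zero_mul, mul_zero, add_zero]
  · intro u hu ε hε
    refine hmodel.not_memLipschitz hU he (c := c) (by simpa [hc] using hb0) rfl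
      (hFR.continuousOn.locallyIntegrableOn hU.measurableSet) hu ?_
    simp only [hc]
    linarith

end Holomorphic

/-! ### The function of one block -/

section Gauge

/-- The contribution `|z|² + |z • z|` of one block to the function defining `Ω_N`. -/
noncomputable def gauge {κ : Type} [Fintype κ] (z : κ → ℂ) : ℝ := euclid z ^ 2 + ‖bullet z z‖

variable {κ : Type} [Fintype κ]

lemma gauge_eq (z : κ → ℂ) : gauge z = ∑ k, ‖z k‖ ^ 2 + ‖∑ k, z k * z k‖ := by
  rw [gauge, euclid, Real.sq_sqrt (Finset.sum_nonneg fun k _ => by positivity), bullet]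

lemma gauge_nonneg (z : κ → ℂ) : 0 ≤ gauge z := by
  rw [gauge]; positivity

lemma continuous_gauge : Continuous (gauge : (κ → ℂ) → ℝ) := by
  have : (gauge : (κ → ℂ) → ℝ) = fun z => ∑ k, ‖z k‖ ^ 2 + ‖∑ k, z k * z k‖ := by
    ext z; exact gauge_eq z
  rw [this]
  fun_prop

lemma norm_sq_le_gauge (z : κ → ℂ) (k : κ) : ‖z k‖ ^ 2 ≤ gauge z := by
  rw [gauge_eq]
  have := Finset.single_le_sum (f := fun k => ‖z k‖ ^ 2) (fun k _ => by positivity)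
    (Finset.mem_univ k)
  linarith [norm_nonneg (∑ k, z k * z k)]

lemma gauge_add_le {x y : κ → ℂ} {R t : ℝ} (ht : t ≤ 1) (hx : ∀ k, ‖x k‖ ≤ R)
    (hy : ∀ k, ‖y k‖ ≤ t) :
    gauge (x + y) ≤ gauge x + Fintype.card κ * (2 * (2 * R + 1) * t) := by
  have hprod (k : κ) : ‖2 * x k * y k + y k * y k‖ ≤ (2 * R + 1) * t ∧
      ‖x k + y k‖ ^ 2 ≤ ‖x k‖ ^ 2 + (2 * R + 1) * t := by
    have h0 := norm_nonneg (x k)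
    have h1 := norm_nonneg (y k)
    have h2 := hx k
    have h3 := hy k
    have e1 : ‖x k‖ * ‖y k‖ ≤ R * t := mul_le_mul h2 h3 h1 (h0.trans h2)
    have e2 : ‖y k‖ * ‖y k‖ ≤ 1 * t := mul_le_mul (h3.trans ht) h3 h1 zero_le_one
    constructor
    · calc _ ≤ ‖2 * x k * y k‖ + ‖y k * y k‖ := norm_add_le _ _
        _ = 2 * (‖x k‖ * ‖y k‖) + ‖y k‖ * ‖y k‖ := by
          rw [norm_mul, norm_mul, norm_mul, Complex.norm_two]; ring
        _ ≤ _ := by linarith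
    · calc _ ≤ (‖x k‖ + ‖y k‖) ^ 2 := pow_le_pow_left₀ (norm_nonneg _) (norm_add_le _ _) 2
        _ = ‖x k‖ ^ 2 + (2 * (‖x k‖ * ‖y k‖) + ‖y k‖ * ‖y k‖) := by ring
        _ ≤ _ := by linarith
  have hs1 : ∑ k, ‖x k + y k‖ ^ 2 ≤ ∑ k, ‖x k‖ ^ 2 + Fintype.card κ * ((2 * R + 1) * t) := by
    refine (Finset.sum_le_sum fun k _ => (hprod k).2).trans_eq ?_
    simp [Finset.sum_add_distrib]
  have hs2 : ‖∑ k, (x k + y k) * (x k + y k)‖ ≤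
      ‖∑ k, x k * x k‖ + Fintype.card κ * ((2 * R + 1) * t) := by
    have : ∑ k, (x k + y k) * (x k + y k) =
        ∑ k, x k * x k + ∑ k, (2 * x k * y k + y k * y k) := by
      rw [← Finset.sum_add_distrib]
      exact Finset.sum_congr rfl fun k _ => by ring
    rw [this]
    refine (norm_add_le _ _).trans (add_le_add_right ?_ _)
    refine (norm_sum_le_of_le _ fun k _ => (hprod k).1).trans_eq ?_
    simp
  rw [gauge_eq, gauge_eq]
  simp only [Pi.add_apply]
  linarith

end Gauge

/-! ### Isotropic coordinates of a block -/

section Block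

/-- The functional `z ↦ z₀ - √-1 z₁`, or `z ↦ 2 z₀` on the line. -/
noncomputable def blockW (n : ℕ) : (Fin n → ℂ) →ₗ[ℂ] ℂ :=
  ∑ k : Fin n, (if k.val = 0 then (if n = 1 then 2 else 1)
    else if k.val = 1 then -Complex.I else 0 : ℂ) • LinearMap.proj k

/-- The functional `z ↦ z₀ + √-1 z₁`. -/
noncomputable def blockV (n : ℕ) : (Fin n → ℂ) →ₗ[ℂ] ℂ :=
  ∑ k : Fin n, (if k.val = 0 then 1 else if k.val = 1 then Complex.I else 0 : ℂ) •
    LinearMap.proj k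

/-- The vector `(1, √-1, 0, …, 0)`, or `1` on the line. -/
noncomputable def isotropic (n : ℕ) : Fin n → ℂ :=
  fun k => if k.val = 0 then 1 else if k.val = 1 then Complex.I else 0

lemma blockW_one (z : Fin 1 → ℂ) : blockW 1 z = 2 * z 0 := by
  simp [blockW]

lemma blockW_add_two {n : ℕ} (z : Fin (n + 2) → ℂ) :
    blockW (n + 2) z = z 0 - Complex.I * z 1 := by
  simp [blockW, Fin.sum_univ_succ, sub_eq_add_neg]

lemma blockV_add_two {n : ℕ} (z : Fin (n + 2) → ℂ) :
    blockV (n + 2) z = z 0 + Complex.I * z 1 := by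
  simp [blockV, Fin.sum_univ_succ]

lemma gauge_one (z : Fin 1 → ℂ) : gauge z = ‖blockW 1 z‖ ^ 2 / 2 := by
  simp [gauge_eq, blockW_one]
  ring

/-- With `w = z₀ - √-1 z₁` and `v = z₀ + √-1 z₁` one has `z₀² + z₁² = w v`, and the parallelogram
law gives `|z₀|² + |z₁|² = (|w|² + |v|²) / 2`. -/
lemma gauge_add_two {n : ℕ} (z : Fin (n + 2) → ℂ) :
    gauge z = ‖blockW (n + 2) z‖ ^ 2 / 2 + ‖blockV (n + 2) z‖ ^ 2 / 2 +
      ∑ k : Fin n, ‖z k.succ.succ‖ ^ 2 +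
      ‖blockW (n + 2) z * blockV (n + 2) z + ∑ k : Fin n, z k.succ.succ * z k.succ.succ‖ := by
  have h1 : blockW (n + 2) z * blockV (n + 2) z = z 0 * z 0 + z 1 * z 1 := by
    rw [blockW_add_two, blockV_add_two]
    linear_combination (-(z 1 * z 1)) * Complex.I_sq
  have h2 : ‖blockW (n + 2) z‖ ^ 2 / 2 + ‖blockV (n + 2) z‖ ^ 2 / 2 = ‖z 0‖ ^ 2 + ‖z 1‖ ^ 2 := by
    rw [blockW_add_two, blockV_add_two]
    have := parallelogram_law_with_norm ℝ (z 0) (Complex.I * z 1)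
    rw [norm_mul, Complex.norm_I, one_mul] at this
    nlinarith
  rw [h1, h2, gauge_eq, Fin.sum_univ_succ, Fin.sum_univ_succ, Fin.sum_univ_succ, Fin.sum_univ_succ]
  simp only [Fin.succ_zero_eq_one]
  ring_nf

lemma norm_blockW_sq_le_gauge {n : ℕ} (hn : 1 ≤ n) (z : Fin n → ℂ) :
    ‖blockW n z‖ ^ 2 / 2 ≤ gauge z := by
  obtain _ | _ | n := n
  · omega
  · exact (gauge_one z).ge
  · rw [gauge_add_two]
    have : 0 ≤ ∑ k : Fin n, ‖z k.succ.succ‖ ^ 2 := Finset.sum_nonneg fun k _ => by positivity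
    have := norm_nonneg (blockW (n + 2) z * blockV (n + 2) z +
      ∑ k : Fin n, z k.succ.succ * z k.succ.succ)
    nlinarith [sq_nonneg ‖blockV (n + 2) z‖]

lemma norm_sq_le_of_gauge_sub_le {n : ℕ} (hn : 1 ≤ n) {z : Fin n → ℂ} {δ : ℝ}
    (h : gauge z - ‖blockW n z‖ ^ 2 / 2 ≤ δ) {k : Fin n} (hk : 2 ≤ k.val) : ‖z k‖ ^ 2 ≤ δ := by
  obtain _ | _ | n := n
  · omega
  · omega
  · rw [gauge_add_two] at h
    obtain ⟨k', rfl⟩ : ∃ k' : Fin n, k = k'.succ.succ :=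
      ⟨⟨k.val - 2, by omega⟩, by ext; simp; omega⟩
    have h1 := Finset.single_le_sum (f := fun k : Fin n => ‖z k.succ.succ‖ ^ 2)
      (fun k _ => by positivity) (Finset.mem_univ k')
    have h2 := norm_nonneg (blockW (n + 2) z * blockV (n + 2) z +
      ∑ k : Fin n, z k.succ.succ * z k.succ.succ)
    nlinarith [sq_nonneg ‖blockV (n + 2) z‖]

/-- In `|w v + ∑ z_k²|` the sum over `k ≥ 2` can cancel at most `∑ |z_k|²`, and that amount is
present separately in `gauge`. Hence `v` is of order `δ`, not `√δ`, wherever `w` stays away from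
`0`. -/
lemma norm_blockW_mul_blockV_le_of_gauge_sub_le {n : ℕ} (hn : 2 ≤ n) {z : Fin n → ℂ} {δ : ℝ}
    (h : gauge z - ‖blockW n z‖ ^ 2 / 2 ≤ δ) : ‖blockW n z‖ * ‖blockV n z‖ ≤ δ := by
  obtain _ | _ | n := n
  · omega
  · omega
  · rw [gauge_add_two] at h
    have h1 : ‖∑ k : Fin n, z k.succ.succ * z k.succ.succ‖ ≤ ∑ k : Fin n, ‖z k.succ.succ‖ ^ 2 :=
      norm_sum_le_of_le _ fun k _ => by rw [norm_mul, sq]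
    have h2 := norm_sub_norm_le (blockW (n + 2) z * blockV (n + 2) z)
      (-∑ k : Fin n, z k.succ.succ * z k.succ.succ)
    rw [sub_neg_eq_add, norm_neg, norm_mul] at h2
    nlinarith [sq_nonneg ‖blockV (n + 2) z‖]

lemma blockW_isotropic {n : ℕ} (hn : 1 ≤ n) : blockW n (isotropic n) = 2 := by
  obtain _ | _ | n := n
  · omega
  · simp [blockW_one, isotropic]
  · simp [blockW_add_two, isotropic]
    norm_num

lemma gauge_smul_isotropic {n : ℕ} (hn : 1 ≤ n) (μ : ℂ) :
    gauge (μ • isotropic n) = 2 * ‖μ‖ ^ 2 := by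
  have hW : blockW n (μ • isotropic n) = μ * 2 := by
    rw [map_smul, blockW_isotropic hn, smul_eq_mul]
  obtain _ | _ | n := n
  · omega
  · rw [gauge_one, hW, norm_mul, Complex.norm_two]; ring
  · have hV : blockV (n + 2) (μ • isotropic (n + 2)) = 0 := by
      rw [map_smul, blockV_add_two]
      simp [isotropic]
    rw [gauge_add_two, hW, hV, norm_mul, Complex.norm_two]
    simp [isotropic]
    ring

/-- Here `v = 0`, so there is no interaction between `μ` and `ν`: the increase is quadratic in `ν`,
which makes the direction tangential. -/
lemma gauge_smul_isotropic_add_single {n : ℕ} (μ ν : ℂ) {k : Fin n} (hk : 2 ≤ k.val) :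
    gauge (μ • isotropic n + Pi.single k ν) = 2 * ‖μ‖ ^ 2 + 2 * ‖ν‖ ^ 2 := by
  obtain _ | _ | n := n
  · exact k.elim0
  · omega
  · obtain ⟨k', rfl⟩ : ∃ k' : Fin n, k = k'.succ.succ :=
      ⟨⟨k.val - 2, by omega⟩, by ext; simp; omega⟩
    have z0 : (μ • isotropic (n + 2) + Pi.single k'.succ.succ ν : Fin (n + 2) → ℂ) 0 = μ := by
      simp [isotropic, Fin.ext_iff]
    have z1 : (μ • isotropic (n + 2) + Pi.single k'.succ.succ ν : Fin (n + 2) → ℂ) 1 =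
        μ * Complex.I := by
      simp [isotropic, Fin.ext_iff]
    have zs (l : Fin n) : (μ • isotropic (n + 2) + Pi.single k'.succ.succ ν : Fin (n + 2) → ℂ)
        l.succ.succ = if l = k' then ν else 0 := by
      simp [isotropic, Pi.single_apply]
    have hW : blockW (n + 2) (μ • isotropic (n + 2) + Pi.single k'.succ.succ ν) = 2 * μ := by
      rw [blockW_add_two, z0, z1]; linear_combination (-μ) * Complex.I_sq
    have hV : blockV (n + 2) (μ • isotropic (n + 2) + Pi.single k'.succ.succ ν) = 0 := by
      rw [blockV_add_two, z0, z1]; linear_combination μ * Complex.I_sq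
    rw [gauge_add_two, hW, hV]
    simp only [zs]
    simp [apply_ite, ite_pow]
    ring

lemma blockW_single_of_two_le {n : ℕ} (ν : ℂ) {k : Fin n} (hk : 2 ≤ k.val) :
    blockW n (Pi.single k ν) = 0 := by
  simp only [blockW, LinearMap.sum_apply, LinearMap.smul_apply, LinearMap.proj_apply]
  refine Finset.sum_eq_zero fun l _ => ?_
  rcases eq_or_ne l k with rfl | h
  · simp [show l.val ≠ 0 by omega, show l.val ≠ 1 by omega]
  · simp [h]

end Block

/-! ### Volumes of linear polydiscs -/

section Volume

variable {ι : Type} [Fintype ι]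

/-- The volume of a linear preimage of a polydisc. -/
lemma exists_volume_polydisc_le {A : (ι → ℂ) →ₗ[ℂ] (ι → ℂ)} (hA : Function.Injective A)
    (c : ι → ℂ) {M : ℝ} (hM : 0 ≤ M) (κ : ι → ℕ) :
    ∃ C : ENNReal, C ≠ ⊤ ∧ ∀ δ : ℝ, 0 < δ →
      volume {Z | ∀ i, ‖A Z i - c i‖ ^ 2 ≤ M * δ ^ κ i} ≤ C * ENNReal.ofReal (δ ^ ∑ i, κ i) := by
  set A' : (ι → ℂ) →ₗ[ℝ] (ι → ℂ) := A.restrictScalars ℝ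
  have hdet : LinearMap.det A' ≠ 0 :=
    (LinearEquiv.ofInjectiveEndo A' hA).isUnit_det'.ne_zero
  set D := ENNReal.ofReal |(LinearMap.det A')⁻¹|
  refine ⟨D * ∏ _i : ι, (ENNReal.ofReal M * NNReal.pi), ?_, fun δ hδ => ?_⟩
  · refine ENNReal.mul_ne_top ENNReal.ofReal_ne_top (ENNReal.prod_ne_top fun i _ => ?_)
    exact ENNReal.mul_ne_top ENNReal.ofReal_ne_top ENNReal.coe_ne_top
  · have hset : {Z | ∀ i, ‖A Z i - c i‖ ^ 2 ≤ M * δ ^ κ i} =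
        A' ⁻¹' (Set.univ.pi fun i => Metric.closedBall (c i) √(M * δ ^ κ i)) := by
      ext Z
      simp only [Set.mem_ofPred_eq, Set.mem_preimage, Set.mem_univ_pi, Metric.mem_closedBall,
        dist_eq_norm]
      refine forall_congr' fun i => ?_
      exact (Real.le_sqrt (norm_nonneg _) (by positivity)).symm
    rw [hset, Measure.addHaar_preimage_linearMap _ hdet, volume_pi_pi, mul_assoc]
    refine mul_le_mul_right (le_of_eq ?_) _
    rw [← Finset.prod_pow_eq_pow_sum, ENNReal.ofReal_prod_of_nonneg fun i _ => by positivity,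
      ← Finset.prod_mul_distrib]
    refine Finset.prod_congr rfl fun i _ => ?_
    rw [Complex.volume_closedBall, ← ENNReal.ofReal_pow (Real.sqrt_nonneg _),
      Real.sq_sqrt (by positivity), ENNReal.ofReal_mul hM]
    ring

end Volume

/-! ### The domain and a criterion for model points -/

section Domain

variable {m : ℕ} {N : Fin m → ℕ}

lemma mem_Omega {Z : Space N} : Z ∈ Omega N ↔ ∑ j, gauge (block Z j) < 1 := Iff.rfl

lemma isOpen_Omega (N : Fin m → ℕ) : IsOpen (Omega N) := by
  have : Continuous fun Z : Space N => ∑ j, gauge (block Z j) :=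
    continuous_finsetSum _ fun j _ => continuous_gauge.comp
      (continuous_pi fun k => continuous_apply _)
  exact isOpen_lt this continuous_const

lemma volume_Omega_lt_top (N : Fin m → ℕ) : volume (Omega N) < ⊤ := by
  refine (measure_mono (t := Metric.closedBall 0 1) fun Z hZ => ?_).trans_lt
    measure_closedBall_lt_top
  rw [mem_closedBall_zero_iff, pi_norm_le_iff_of_nonneg zero_le_one]
  rintro ⟨j, k⟩
  have h1 := norm_sq_le_gauge (block Z j) k
  have h2 := Finset.single_le_sum (f := fun j => gauge (block Z j))
    (fun j _ => gauge_nonneg _) (Finset.mem_univ j)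
  have h3 := mem_Omega.1 hZ
  have h4 : ‖Z ⟨j, k⟩‖ ^ 2 ≤ 1 := (h1.trans h2).trans h3.le
  nlinarith [norm_nonneg (Z ⟨j, k⟩)]

/-- Moving inward gains at least `t`, since `(1 - t)² ≤ 1 - t`. This absorbs the quadratic loss `A
‖ζ‖²` along `e` and the linear loss `C ‖Y‖` in the other variables. The choice `η = 1 / (2 + A + C)`
leaves the margin `2ηt`. -/
lemma isModelPoint_Omega {G : Space N → ℂ} {Z₀ e : Space N} {A B : ℝ} (hA : 0 ≤ A) (hB : 0 ≤ B)
    (hgauge : ∀ (t : ℝ) (ζ : ℂ), t ≤ 1 →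
      ∑ j, gauge (block ((1 - t) • Z₀ + ζ • e) j) ≤ (1 - t) ^ 2 + A * ‖ζ‖ ^ 2)
    (hG : ∀ (t : ℝ) (ζ : ℂ) (Y : Space N), 0 < t → t ≤ 1 → ‖ζ‖ ≤ 1 → ‖Y‖ ≤ 1 →
      ‖G ((1 - t) • Z₀ + (Y + ζ • e)) - t‖ ≤ B * (t ^ 2 + ‖ζ‖ ^ 2 + ‖Y‖)) :
    IsModelPoint (Omega N) G Z₀ e := by
  set R : ℝ := ‖Z₀‖ + ‖e‖
  set C : ℝ := ∑ j, (N j : ℝ) * (2 * (2 * R + 1))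
  have hR : 0 ≤ R := by positivity
  have hC : 0 ≤ C := Finset.sum_nonneg fun j _ => by positivity
  have hη : 0 < 1 / (2 + A + C) := by positivity
  have hη1 : 1 / (2 + A + C) ≤ 1 := by rw [div_le_one (by positivity)]; linarith
  have hηm : (2 + A + C) * (1 / (2 + A + C)) = 1 := mul_one_div_cancel (by positivity)
  refine ⟨B, 1 / (2 + A + C), hB, hη, fun t ht htη ζ Y hζ hY => ?_⟩
  set η := 1 / (2 + A + C)
  have ht1 : t ≤ 1 := htη.trans hη1
  have hηt : η * t ≤ 1 := mul_le_one₀ hη1 ht.le ht1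
  have hζ1 : ‖ζ‖ ≤ 1 := by nlinarith [norm_nonneg ζ]
  have hY1 : ‖Y‖ ≤ 1 := hY.trans hηt
  refine ⟨?_, hG t ζ Y ht ht1 hζ1 hY1⟩
  set X : Space N := (1 - t) • Z₀ + ζ • e with hX
  have hXR : ‖X‖ ≤ R := by
    refine (norm_add_le _ _).trans (add_le_add ?_ ?_)
    · rw [norm_smul, Real.norm_of_nonneg (by linarith)]
      exact mul_le_of_le_one_left (norm_nonneg _) (by linarith)
    · rw [norm_smul]
      exact mul_le_of_le_one_left (norm_nonneg _) hζ1
  have hXY : (1 - t) • Z₀ + (Y + ζ • e) = X + Y := by rw [hX]; abel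
  rw [hXY, mem_Omega]
  have hsum : ∑ j, gauge (block (X + Y) j) ≤ ∑ j, gauge (block X j) + C * ‖Y‖ := by
    rw [Finset.sum_mul, ← Finset.sum_add_distrib]
    refine Finset.sum_le_sum fun j _ => ?_
    have := gauge_add_le (x := block X j) (y := block Y j) (R := R) hY1
      (fun k => (norm_le_pi_norm X ⟨j, k⟩).trans hXR) (fun k => norm_le_pi_norm Y ⟨j, k⟩)
    rw [Fintype.card_fin] at this
    rw [mul_assoc]
    exact this
  have h1 := hgauge t ζ ht1
  have h2 : A * ‖ζ‖ ^ 2 ≤ A * (η * t) := mul_le_mul_of_nonneg_left hζ hA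
  have h3 : C * ‖Y‖ ≤ C * (η * t) := mul_le_mul_of_nonneg_left hY hC
  nlinarith

end Domain

/-! ### The peak function and its tangential directions -/

section Linear

variable {m : ℕ} (N : Fin m → ℕ)

/-- The block `Z ↦ Z_j` as a linear map. -/
def blockL (j : Fin m) : Space N →ₗ[ℂ] (Fin (N j) → ℂ) :=
  LinearMap.funLeft ℂ ℂ fun k => ⟨j, k⟩

variable {N} in
lemma blockL_apply (j : Fin m) (Z : Space N) : blockL N j Z = block Z j := rfl

/-- The linear function `∑_j w_j`, where `w_j` is the first isotropic coordinate of the `j`-th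
block. -/
noncomputable def sumW : Space N →L[ℂ] ℂ :=
  LinearMap.toContinuousLinearMap (∑ j, blockW (N j) ∘ₗ blockL N j)

lemma sumW_apply (Z : Space N) : sumW N Z = ∑ j, blockW (N j) (block Z j) := by
  simp [sumW]
  rfl

/-- The boundary point of `Ω_N` all of whose blocks are isotropic of the same length. -/
noncomputable def basePoint : Space N := fun i => ((√(2 * m))⁻¹ : ℝ) * isotropic (N i.1) i.2

variable {N}

lemma block_smul_basePoint_add (t : ℝ) (Y : Space N) (j : Fin m) :
    block (t • basePoint N + Y) j = ((t * (√(2 * m))⁻¹ : ℝ) : ℂ) • isotropic (N j) + block Y j := by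
  ext k
  simp [block, basePoint]
  ring

lemma sumW_basePoint (hm : 0 < m) (hpos : ∀ j, 1 ≤ N j) :
    ((√(2 * m))⁻¹ : ℝ) * sumW N (basePoint N) = (1 : ℂ) := by
  have hj (j : Fin m) : blockW (N j) (block (basePoint N) j) = ((√(2 * m))⁻¹ : ℝ) * 2 := by
    have : block (basePoint N) j = (((√(2 * m))⁻¹ : ℝ) : ℂ) • isotropic (N j) := rfl
    rw [this, map_smul, blockW_isotropic (hpos j), smul_eq_mul]
  rw [sumW_apply]
  simp_rw [hj]
  rw [Finset.sum_const, Finset.card_univ, Fintype.card_fin, nsmul_eq_mul]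
  have hsq : (√(2 * m))⁻¹ ^ 2 * (2 * m) = (1 : ℝ) := by
    rw [inv_pow, Real.sq_sqrt (by positivity)]
    exact inv_mul_cancel₀ (by positivity)
  have : ((((√(2 * m))⁻¹ ^ 2 * (2 * m) : ℝ)) : ℂ) = 1 := by rw [hsq]; simp
  rw [← this]
  push_cast
  ring

/-- The holomorphic function `1 - (2m)^{-1/2} ∑_j w_j`, which vanishes at `basePoint N`. -/
noncomputable def peak (N : Fin m → ℕ) (Z : Space N) : ℂ := 1 - ((√(2 * m))⁻¹ : ℝ) * sumW N Z

lemma contDiff_peak : ContDiff ℂ ∞ (peak N) := by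
  unfold peak
  fun_prop

/-- Write `a = (2m)^{-1/2}`, so `2m a² = 1`, and complete the squares in `|w_j - 2a|²`. On the
domain the three contributions are nonnegative and the first is positive, so a small real part makes
each of them small. -/
lemma two_mul_re_peak (hm : 0 < m) (Z : Space N) :
    2 * (peak N Z).re = 1 - ∑ j, gauge (block Z j) +
      ∑ j, (gauge (block Z j) - ‖blockW (N j) (block Z j)‖ ^ 2 / 2) +
      (∑ j, ‖blockW (N j) (block Z j) - (2 * (√(2 * m))⁻¹ : ℝ)‖ ^ 2) / 2 := by
  set a := (√(2 * m))⁻¹ with ha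
  have hsq : a ^ 2 * (2 * m) = (1 : ℝ) := by
    rw [ha, inv_pow, Real.sq_sqrt (by positivity)]
    exact inv_mul_cancel₀ (by positivity)
  have hn (w : ℂ) : ‖w - (2 * a : ℝ)‖ ^ 2 = ‖w‖ ^ 2 - 4 * a * w.re + 4 * a ^ 2 := by
    rw [Complex.sq_norm, Complex.sq_norm, Complex.normSq_apply, Complex.normSq_apply]
    simp
    ring
  simp_rw [hn]
  simp only [peak, sumW_apply, Complex.sub_re, Complex.one_re, Complex.re_ofReal_mul,
    Complex.re_sum, Finset.sum_sub_distrib, Finset.sum_add_distrib, ← Finset.sum_div,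
    ← Finset.mul_sum, Finset.sum_const, Finset.card_univ, Fintype.card_fin, nsmul_eq_mul]
  rw [← ha]
  linear_combination -hsq

lemma re_peak_pos (hm : 0 < m) (hpos : ∀ j, 1 ≤ N j) {Z : Space N} (hZ : Z ∈ Omega N) :
    0 < (peak N Z).re := by
  have h := two_mul_re_peak hm Z
  have h1 := mem_Omega.1 hZ
  have h2 : 0 ≤ ∑ j, (gauge (block Z j) - ‖blockW (N j) (block Z j)‖ ^ 2 / 2) :=
    Finset.sum_nonneg fun j _ => by linarith [norm_blockW_sq_le_gauge (hpos j) (block Z j)]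
  have h3 : 0 ≤ ∑ j, ‖blockW (N j) (block Z j) - (2 * (√(2 * m))⁻¹ : ℝ)‖ ^ 2 :=
    Finset.sum_nonneg fun j _ => by positivity
  linarith

/-- `peak N` is affine, equals `t` at `(1 - t) Z₀` and is constant along `e`, so the error depends
on `Y` alone. -/
lemma norm_peak_sub_le (hm : 0 < m) (hpos : ∀ j, 1 ≤ N j) {e : Space N} (he : sumW N e = 0) :
    ∃ B : ℝ, 0 ≤ B ∧ ∀ (t : ℝ) (ζ : ℂ) (Y : Space N),
      ‖peak N ((1 - t) • basePoint N + (Y + ζ • e)) - t‖ ≤ B * (t ^ 2 + ‖ζ‖ ^ 2 + ‖Y‖) := by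
  refine ⟨|(√(2 * m))⁻¹| * ‖sumW N‖, by positivity, fun t ζ Y => ?_⟩
  have hreal : sumW N ((1 - t) • basePoint N) = ((1 - t : ℝ) : ℂ) * sumW N (basePoint N) := by
    have : (1 - t) • basePoint N = ((1 - t : ℝ) : ℂ) • basePoint N := by ext i; simp
    rw [this, map_smul, smul_eq_mul]
  have : peak N ((1 - t) • basePoint N + (Y + ζ • e)) - t = -(((√(2 * m))⁻¹ : ℝ) * sumW N Y) := by
    rw [peak, map_add, map_add, hreal, map_smul, he]
    have h := sumW_basePoint hm hpos
    push_cast at h ⊢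
    simp only [smul_zero, add_zero]
    linear_combination (-(1 - (t : ℂ))) * h
  rw [this, norm_neg, norm_mul, Complex.norm_real, Real.norm_eq_abs]
  have h1 : ‖sumW N Y‖ ≤ ‖sumW N‖ * ‖Y‖ := (sumW N).le_opNorm Y
  calc _ ≤ |(√(2 * m))⁻¹| * (‖sumW N‖ * ‖Y‖) := mul_le_mul_of_nonneg_left h1 (abs_nonneg _)
    _ = |(√(2 * m))⁻¹| * ‖sumW N‖ * ‖Y‖ := by ring
    _ ≤ _ := mul_le_mul_of_nonneg_left (by nlinarith [sq_nonneg t, sq_nonneg ‖ζ‖]) (by positivity)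

lemma isModelPoint_single (hm : 0 < m) (hpos : ∀ j, 1 ≤ N j) (j₀ : Fin m) (k₀ : Fin (N j₀))
    (hk : 2 ≤ k₀.val) :
    IsModelPoint (Omega N) (peak N) (basePoint N) (Pi.single ⟨j₀, k₀⟩ 1) := by
  have hb (ζ : ℂ) (j : Fin m) : block (ζ • (Pi.single ⟨j₀, k₀⟩ 1 : Space N)) j =
      if h : j = j₀ then Pi.single (h ▸ k₀) ζ else 0 := by
    split_ifs with h
    · subst h
      ext k
      rcases eq_or_ne k k₀ with rfl | hne
      · simp [block]
      · simp [block, hne]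
    · ext k
      simp [block, h]
  have hW : sumW N (Pi.single ⟨j₀, k₀⟩ 1) = 0 := by
    rw [sumW_apply]
    refine Finset.sum_eq_zero fun j _ => ?_
    have := hb 1 j
    rw [one_smul] at this
    rw [this]
    split_ifs with h
    · subst h
      exact blockW_single_of_two_le 1 hk
    · simp
  obtain ⟨B, hB, hG⟩ := norm_peak_sub_le hm hpos hW
  refine isModelPoint_Omega (A := 2) (by norm_num) hB (fun t ζ ht => ?_)
    fun t ζ Y _ _ _ _ => hG t ζ Y
  have hgj (j : Fin m) : gauge (block ((1 - t) • basePoint N + ζ • Pi.single ⟨j₀, k₀⟩ 1) j) =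
      2 * ((1 - t) * (√(2 * m))⁻¹) ^ 2 + if j = j₀ then 2 * ‖ζ‖ ^ 2 else 0 := by
    rw [block_smul_basePoint_add, hb]
    split_ifs with h
    · subst h
      rw [gauge_smul_isotropic_add_single _ _ hk, Complex.norm_real, Real.norm_eq_abs, sq_abs]
    · rw [add_zero, gauge_smul_isotropic (hpos j), Complex.norm_real, Real.norm_eq_abs, sq_abs,
        add_zero]
  simp_rw [hgj]
  rw [Finset.sum_add_distrib, Finset.sum_ite_eq' Finset.univ j₀]
  simp only [Finset.sum_const, Finset.card_univ, Fintype.card_fin, nsmul_eq_mul,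
    Finset.mem_univ, if_true]
  rw [mul_pow, inv_pow, Real.sq_sqrt (by positivity)]
  apply le_of_eq
  field_simp

lemma isModelPoint_isotropic (hm : 0 < m) (hpos : ∀ j, 1 ≤ N j) {σ : Fin m → ℝ}
    (hσ : ∑ j, σ j = 0) :
    IsModelPoint (Omega N) (peak N) (basePoint N) (fun i => σ i.1 * isotropic (N i.1) i.2) := by
  set e : Space N := fun i => σ i.1 * isotropic (N i.1) i.2
  have hb (ζ : ℂ) (j : Fin m) : block (ζ • e) j = (ζ * σ j) • isotropic (N j) := by
    ext k
    simp [block, e]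
    ring
  have hW : sumW N e = 0 := by
    rw [sumW_apply]
    have hj (j : Fin m) : blockW (N j) (block e j) = (σ j : ℂ) * 2 := by
      have := hb 1 j
      rw [one_smul, one_mul] at this
      rw [this, map_smul, blockW_isotropic (hpos j), smul_eq_mul]
    simp_rw [hj]
    rw [← Finset.sum_mul, ← Complex.ofReal_sum, hσ]
    simp
  obtain ⟨B, hB, hG⟩ := norm_peak_sub_le hm hpos hW
  refine isModelPoint_Omega (A := 2 * ∑ j, σ j ^ 2)
    (mul_nonneg zero_le_two (Finset.sum_nonneg fun j _ => sq_nonneg _)) hB (fun t ζ ht => ?_)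
    fun t ζ Y _ _ _ _ => hG t ζ Y
  set x := (1 - t) * (√(2 * m))⁻¹ with hx
  have hgj (j : Fin m) : gauge (block ((1 - t) • basePoint N + ζ • e) j) =
      2 * x ^ 2 + 4 * x * ζ.re * σ j + 2 * ‖ζ‖ ^ 2 * σ j ^ 2 := by
    rw [block_smul_basePoint_add, hb, ← add_smul, gauge_smul_isotropic (hpos j), ← hx,
      Complex.sq_norm, Complex.sq_norm, Complex.normSq_apply, Complex.normSq_apply]
    simp
    ring
  simp_rw [hgj]
  rw [Finset.sum_add_distrib, Finset.sum_add_distrib]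
  simp only [Finset.sum_const, Finset.card_univ, Fintype.card_fin, nsmul_eq_mul]
  -- The terms linear in `ζ` cancel between the blocks because `∑ σ j = 0`; only a quadratic loss
  -- remains.
  rw [← Finset.mul_sum, ← Finset.mul_sum, hσ]
  rw [hx, mul_pow, inv_pow, Real.sq_sqrt (by positivity)]
  apply le_of_eq
  field_simp
  ring

end Linear

/-! ### Volume of the sublevel sets of the peak function -/

section PeakVolume

variable {m : ℕ} (N : Fin m → ℕ)

/-- Linear coordinates of `ℂ^N`: the function `∑_j w_j`, the isotropic coordinates of the blocks
and the remaining coordinates. -/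
noncomputable def isotropicCoord (j₀ : Fin m) : Space N →ₗ[ℂ] Space N :=
  LinearMap.pi fun i =>
    if i.2.val = 0 then
      (if i.1 = j₀ then (sumW N : Space N →ₗ[ℂ] ℂ) else blockW (N i.1) ∘ₗ blockL N i.1)
    else if i.2.val = 1 then blockV (N i.1) ∘ₗ blockL N i.1
    else LinearMap.proj i

/-- The orders of magnitude of the isotropic coordinates where `peak N` is small. -/
def isotropicWeight (j₀ : Fin m) (i : Σ j : Fin m, Fin (N j)) : ℕ :=
  if i.2.val = 0 then (if i.1 = j₀ then 2 else 1) else if i.2.val = 1 then 2 else 1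

variable {N}

lemma isotropicCoord_injective (hpos : ∀ j, 1 ≤ N j) (j₀ : Fin m) :
    Function.Injective (isotropicCoord N j₀) := by
  rw [← LinearMap.ker_eq_bot, LinearMap.ker_eq_bot']
  intro Z hZ
  have hi (i) : isotropicCoord N j₀ Z i = 0 := by rw [hZ]; rfl
  have hW' (j : Fin m) (hj : j ≠ j₀) : blockW (N j) (block Z j) = 0 := by
    have := hi ⟨j, ⟨0, hpos j⟩⟩
    simpa [isotropicCoord, hj, blockL_apply] using this
  have hW (j : Fin m) : blockW (N j) (block Z j) = 0 := by
    rcases eq_or_ne j j₀ with rfl | hj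
    · have h := hi ⟨j, ⟨0, hpos j⟩⟩
      have h2 : sumW N Z = 0 := by simpa [isotropicCoord] using h
      rwa [sumW_apply, Finset.sum_eq_single j (fun b _ hb => hW' b hb) (by simp)] at h2
    · exact hW' j hj
  have hV (j : Fin m) (h2 : 2 ≤ N j) : blockV (N j) (block Z j) = 0 := by
    have := hi ⟨j, ⟨1, h2⟩⟩
    simpa [isotropicCoord, blockL_apply] using this
  have hz (j : Fin m) : block Z j = 0 := by
    have hk (k : Fin (N j)) (hk : 2 ≤ k.val) : block Z j k = 0 := by
      have : isotropicCoord N j₀ Z ⟨j, k⟩ = 0 := hi ⟨j, k⟩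
      have h0 : Z ⟨j, k⟩ = 0 := by
        simpa [isotropicCoord, show k.val ≠ 0 by omega, show k.val ≠ 1 by omega] using this
      exact h0
    have hWj := hW j
    have hVj := hV j
    have hn := hpos j
    generalize block Z j = z at *
    revert z
    generalize N j = n at *
    intro z hk hWj hVj
    obtain _ | _ | n := n
    · omega
    · ext k
      rw [blockW_one] at hWj
      fin_cases k
      simpa using hWj
    · have hVj := hVj (by omega)
      rw [blockW_add_two] at hWj
      rw [blockV_add_two] at hVj
      ext k
      rcases Nat.lt_or_ge k.val 2 with h | h
      · have hk' : k = 0 ∨ k = 1 := by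
          rcases Nat.lt_or_ge k.val 1 with h' | h'
          · exact Or.inl (Fin.ext (show k.val = 0 by omega))
          · exact Or.inr (Fin.ext (show k.val = 1 by omega))
        rcases hk' with rfl | rfl
        · simp only [Pi.zero_apply]; linear_combination (hWj + hVj) / 2
        · simp only [Pi.zero_apply]
          linear_combination (Complex.I * (hWj - hVj)) / 2 + z 1 * Complex.I_sq
      · simpa using hk k h
  ext ⟨j, k⟩
  exact congrFun (hz j) k

/-- Every coordinate counts once. One extra unit comes from `∑ w_j`, known to order `δ`, and one
from the coordinate `v_j` of each block with `n_j ≥ 2`. -/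
lemma sum_isotropicWeight (hpos : ∀ j, 1 ≤ N j) (j₀ : Fin m) :
    ∑ i, isotropicWeight N j₀ i = (∑ j, N j) + (m - numOnes N) + 1 := by
  have hblock (n : ℕ) (hn : 1 ≤ n) (c : ℕ) :
      ∑ k : Fin n, (if k.val = 0 then c + 1 else if k.val = 1 then 2 else 1) =
        n + c + if n = 1 then 0 else 1 := by
    obtain _ | _ | n := n
    · omega
    · simp; omega
    · simp [Fin.sum_univ_succ]; omega
  have hj (j : Fin m) : ∑ k : Fin (N j), isotropicWeight N j₀ ⟨j, k⟩ =
      N j + (if j = j₀ then 1 else 0) + if N j = 1 then 0 else 1 := by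
    rw [← hblock (N j) (hpos j)]
    refine Finset.sum_congr rfl fun k _ => ?_
    simp only [isotropicWeight]
    split_ifs <;> rfl
  have hcard : ∑ j, (if N j = 1 then 0 else 1) = m - numOnes N := by
    have h1 := Finset.card_filter_add_card_filter_not (s := (Finset.univ : Finset (Fin m)))
      (fun j => N j = 1)
    rw [Finset.card_univ, Fintype.card_fin] at h1
    have h2 : ∑ j, (if N j = 1 then 0 else 1) = (Finset.univ.filter fun j => ¬ N j = 1).card := by
      rw [Finset.card_filter]
      exact Finset.sum_congr rfl fun j _ => by split_ifs <;> simp_all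
    rw [h2, numOnes]
    omega
  rw [Fintype.sum_sigma]
  simp_rw [hj]
  rw [Finset.sum_add_distrib, Finset.sum_add_distrib, hcard, Finset.sum_ite_eq' Finset.univ j₀]
  simp
  omega

/-- The smallness of `|peak N|`, not just of its real part, fixes `∑ w_j` to order `δ`. The identity
`two_mul_re_peak` fixes each `w_j` and each remaining coordinate to order `√δ`, and the product
bound fixes `v_j` to order `δ`. -/
lemma isotropicCoord_sub_le (hm : 0 < m) (hpos : ∀ j, 1 ≤ N j) (j₀ : Fin m) {Z : Space N}
    (hZ : Z ∈ Omega N) {δ : ℝ} (hδ : 0 < δ) (hδle : δ ≤ (√(2 * m))⁻¹ ^ 2 / 4)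
    (hG : ‖peak N Z‖ ≤ δ) (i) :
    ‖isotropicCoord N j₀ Z i - (if i.2.val = 0 then (if i.1 = j₀ then (√(2 * m) : ℂ)
      else (2 * (√(2 * m))⁻¹ : ℝ)) else 0)‖ ^ 2 ≤
      (4 + 16 * (2 * m)) * δ ^ isotropicWeight N j₀ i := by
  have h0 := two_mul_re_peak hm Z
  set a := (√(2 * m))⁻¹ with ha
  have hmR : (0 : ℝ) < m := by exact_mod_cast hm
  have hapos : 0 < a := by positivity
  have hasq : a ^ 2 * (2 * m) = (1 : ℝ) := by
    rw [ha, inv_pow, Real.sq_sqrt (by positivity)]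
    exact inv_mul_cancel₀ (by positivity)
  have hre : 2 * (peak N Z).re ≤ 2 * δ := by linarith [Complex.re_le_norm (peak N Z)]
  have hd (j : Fin m) : 0 ≤ gauge (block Z j) - ‖blockW (N j) (block Z j)‖ ^ 2 / 2 := by
    linarith [norm_blockW_sq_le_gauge (hpos j) (block Z j)]
  have hs1 := Finset.sum_nonneg fun j (_ : j ∈ Finset.univ) => hd j
  have hs2 : 0 ≤ ∑ j, ‖blockW (N j) (block Z j) - (2 * a : ℝ)‖ ^ 2 :=
    Finset.sum_nonneg fun j _ => by positivity
  have hlt := mem_Omega.1 hZ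
  have hw (j : Fin m) : ‖blockW (N j) (block Z j) - (2 * a : ℝ)‖ ^ 2 ≤ 4 * δ := by
    have := Finset.single_le_sum (f := fun j => ‖blockW (N j) (block Z j) - (2 * a : ℝ)‖ ^ 2)
      (fun j _ => by positivity) (Finset.mem_univ j)
    linarith
  have hg (j : Fin m) : gauge (block Z j) - ‖blockW (N j) (block Z j)‖ ^ 2 / 2 ≤ 2 * δ := by
    have := Finset.single_le_sum
      (f := fun j => gauge (block Z j) - ‖blockW (N j) (block Z j)‖ ^ 2 / 2)
      (fun j _ => hd j) (Finset.mem_univ j)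
    linarith
  obtain ⟨j, k⟩ := i
  by_cases hk0 : k.val = 0
  · by_cases hj : j = j₀
    · subst hj
      have he : isotropicCoord N j Z ⟨j, k⟩ = sumW N Z := by simp [isotropicCoord, hk0]
      have hpk : sumW N Z - (√(2 * m) : ℂ) = -((√(2 * m) : ℝ) : ℂ) * peak N Z := by
        have : ((√(2 * m) : ℝ) : ℂ) * ((√(2 * m))⁻¹ : ℝ) = 1 := by
          rw [← Complex.ofReal_mul, mul_inv_cancel₀ (by positivity)]; simp
        rw [peak]
        linear_combination (-(sumW N Z)) * this
      have hn : ‖peak N Z‖ ^ 2 ≤ δ ^ 2 := pow_le_pow_left₀ (norm_nonneg _) hG 2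
      simp only [he, hk0, if_true, isotropicWeight]
      rw [hpk, norm_mul, norm_neg, Complex.norm_real, Real.norm_of_nonneg (by positivity), mul_pow,
        Real.sq_sqrt (by positivity)]
      exact mul_le_mul (by linarith) hn (by positivity) (by positivity)
    · have he : isotropicCoord N j₀ Z ⟨j, k⟩ = blockW (N j) (block Z j) := by
        simp [isotropicCoord, hk0, hj]; rfl
      simp only [he, hk0, if_true, isotropicWeight, if_neg hj, pow_one]
      nlinarith [hw j]
  · by_cases hk1 : k.val = 1
    · have he : isotropicCoord N j₀ Z ⟨j, k⟩ = blockV (N j) (block Z j) := by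
        simp [isotropicCoord, hk1]; rfl
      have hp := norm_blockW_mul_blockV_le_of_gauge_sub_le (n := N j) (by omega) (hg j)
      -- The restriction `δ ≤ a² / 4` serves this purpose: `|w_j - 2a|² ≤ 4δ ≤ a²` keeps `w_j` away
      -- from `0`.
      have hwa : a ≤ ‖blockW (N j) (block Z j)‖ := by
        have h1 : ‖blockW (N j) (block Z j) - (2 * a : ℝ)‖ ≤ a := by
          refine le_of_sq_le_sq ?_ hapos.le
          linarith [hw j]
        have h2 := norm_sub_norm_le ((2 * a : ℝ) : ℂ) (blockW (N j) (block Z j))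
        rw [norm_sub_rev, Complex.norm_real, Real.norm_of_nonneg (by positivity)] at h2
        linarith
      have hav : a * ‖blockV (N j) (block Z j)‖ ≤ 2 * δ :=
        (mul_le_mul_of_nonneg_right hwa (norm_nonneg _)).trans hp
      simp only [he, hk1, one_ne_zero, if_false, if_true, isotropicWeight, sub_zero]
      have hsq := pow_le_pow_left₀ (by positivity) hav 2
      have : ‖blockV (N j) (block Z j)‖ ^ 2 =
          (2 * m) * (a * ‖blockV (N j) (block Z j)‖) ^ 2 := by
        rw [mul_pow]; linear_combination (-‖blockV (N j) (block Z j)‖ ^ 2) * hasq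
      rw [this]
      nlinarith [sq_nonneg δ, mul_le_mul_of_nonneg_left hsq hmR.le]
    · have he : isotropicCoord N j₀ Z ⟨j, k⟩ = block Z j k := by
        simp [isotropicCoord, hk0, hk1]; rfl
      have := norm_sq_le_of_gauge_sub_le (hpos j) (hg j) (k := k) (by omega)
      simp only [he, hk0, hk1, if_false, isotropicWeight, sub_zero, pow_one]
      nlinarith

/-- The volume of the part of `Ω_N` where `peak N` is small. -/
lemma exists_volume_peak_le (hm : 0 < m) (hpos : ∀ j, 1 ≤ N j) :
    ∃ C : ENNReal, C ≠ ⊤ ∧ ∀ δ : ℝ, 0 < δ → δ ≤ (√(2 * m))⁻¹ ^ 2 / 4 →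
      volume {Z ∈ Omega N | ‖peak N Z‖ ≤ δ} ≤
        C * ENNReal.ofReal (δ ^ ((∑ j, N j) + (m - numOnes N) + 1)) := by
  obtain ⟨C, hC, h⟩ := exists_volume_polydisc_le (isotropicCoord_injective hpos ⟨0, hm⟩)
    (fun i => if i.2.val = 0 then (if i.1 = ⟨0, hm⟩ then (√(2 * m) : ℂ)
      else (2 * (√(2 * m))⁻¹ : ℝ)) else 0) (M := 4 + 16 * (2 * m)) (by positivity)
    (isotropicWeight N ⟨0, hm⟩)
  refine ⟨C, hC, fun δ hδ hδle => ?_⟩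
  rw [← sum_isotropicWeight hpos ⟨0, hm⟩]
  refine (measure_mono fun Z hZ => ?_).trans (h δ hδ)
  exact fun i => isotropicCoord_sub_le hm hpos ⟨0, hm⟩ hZ.1 hδ hδle hZ.2 i

end PeakVolume

/-! ### The exceptional case of a single block of dimension two -/

section BallPair

/-- The holomorphic function `(1 - 2 z₁² - z₂²) / 2` on `ℂ²`. -/
noncomputable def peakTwo (Z : Space (fun _ : Fin 1 => 2)) : ℂ :=
  (1 - 2 * Z ⟨0, 0⟩ ^ 2 - Z ⟨0, 1⟩ ^ 2) / 2

lemma contDiff_peakTwo : ContDiff ℂ ∞ peakTwo := by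
  unfold peakTwo
  have h (i) : ContDiff ℂ ∞ fun Z : Space (fun _ : Fin 1 => 2) => Z i := contDiff_apply ℂ ℂ i
  exact ((contDiff_const.sub (contDiff_const.mul ((h _).pow 2))).sub ((h _).pow 2)).div_const _

lemma sum_gauge_two (Z : Space (fun _ : Fin 1 => 2)) : ∑ j, gauge (block Z j) =
    ‖Z ⟨0, 0⟩‖ ^ 2 + ‖Z ⟨0, 1⟩‖ ^ 2 + ‖Z ⟨0, 0⟩ ^ 2 + Z ⟨0, 1⟩ ^ 2‖ := by
  rw [Fin.sum_univ_one, gauge_eq, Fin.sum_univ_two, Fin.sum_univ_two]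
  simp [block, sq]

/-- Split `2 peakTwo = 1 - z₁² - (z₁² + z₂²)` and bound both real parts by moduli; the defining
inequality of the domain then leaves exactly `|z₂|²`. -/
lemma norm_sq_lt_re_peakTwo {Z : Space (fun _ : Fin 1 => 2)} (hZ : Z ∈ Omega fun _ : Fin 1 => 2) :
    ‖Z ⟨0, 1⟩‖ ^ 2 < 2 * (peakTwo Z).re := by
  have h := mem_Omega.1 hZ
  rw [sum_gauge_two] at h
  have h1 := Complex.re_le_norm (Z ⟨0, 0⟩ ^ 2 + Z ⟨0, 1⟩ ^ 2)
  have h2 := Complex.re_le_norm (Z ⟨0, 0⟩ ^ 2)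
  rw [norm_pow] at h2
  have h3 : 2 * (peakTwo Z).re = 1 - (Z ⟨0, 0⟩ ^ 2).re - (Z ⟨0, 0⟩ ^ 2 + Z ⟨0, 1⟩ ^ 2).re := by
    have : peakTwo Z = ((1 / 2 : ℝ) : ℂ) * (1 - Z ⟨0, 0⟩ ^ 2 - (Z ⟨0, 0⟩ ^ 2 + Z ⟨0, 1⟩ ^ 2)) := by
      rw [peakTwo]; push_cast; ring
    rw [this, Complex.re_ofReal_mul, Complex.sub_re, Complex.sub_re, Complex.one_re]
    ring
  linarith

lemma re_peakTwo_pos {Z : Space (fun _ : Fin 1 => 2)} (hZ : Z ∈ Omega fun _ : Fin 1 => 2) :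
    0 < (peakTwo Z).re := by
  nlinarith [norm_sq_lt_re_peakTwo hZ, sq_nonneg ‖Z ⟨0, 1⟩‖]

lemma norm_sub_or_add_le_of_norm_sq_sub_le {z : ℂ} {a δ : ℝ} (ha : 0 < a)
    (h : ‖z ^ 2 - (a : ℂ) ^ 2‖ ≤ δ) : ‖z - a‖ ≤ δ / a ∨ ‖z + a‖ ≤ δ / a := by
  have hmul : ‖z - a‖ * ‖z + a‖ ≤ δ := by
    rw [← norm_mul]
    convert h using 2
    ring
  have hsum : 2 * a ≤ ‖z - a‖ + ‖z + a‖ := by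
    have := norm_sub_le (z + a) (z - a)
    have e : z + a - (z - a) = ((2 * a : ℝ) : ℂ) := by push_cast; ring
    rw [e, Complex.norm_real, Real.norm_of_nonneg (by positivity)] at this
    linarith
  rcases le_total ‖z - a‖ ‖z + a‖ with h1 | h1
  · left
    rw [le_div_iff₀ ha]
    nlinarith [norm_nonneg (z - a)]
  · right
    rw [le_div_iff₀ ha]
    nlinarith [norm_nonneg (z + a)]

/-- The volume of the part of the domain in `ℂ²` where `peakTwo` is small. -/
lemma exists_volume_peakTwo_le :
    ∃ C : ENNReal, C ≠ ⊤ ∧ ∀ δ : ℝ, 0 < δ →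
      volume {Z ∈ Omega (fun _ : Fin 1 => 2) | ‖peakTwo Z‖ ≤ δ} ≤ C * ENNReal.ofReal (δ ^ 3) := by
  -- On the sublevel set `z₂` is of order `√δ` and `z₁² - 1/2` of order `δ`, so `z₁` is within order
  -- `δ` of one of `±1/√2`; this yields two polydiscs of volume of order `δ³`.
  set κ : (Σ _j : Fin 1, Fin 2) → ℕ := fun i => if i.2 = 0 then 2 else 1 with hκ
  have hκsum : ∑ i, κ i = 3 := by
    rw [Fintype.sum_sigma, Fin.sum_univ_one, Fin.sum_univ_two]; simp [hκ]
  set a : ℝ := (√2)⁻¹ with ha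
  have hapos : 0 < a := by positivity
  have hasq : a ^ 2 = 1 / 2 := by rw [ha, inv_pow, Real.sq_sqrt (by norm_num)]; norm_num
  have hinj : Function.Injective (LinearMap.id : Space (fun _ : Fin 1 => 2) →ₗ[ℂ] _) :=
    Function.injective_id
  obtain ⟨C₁, hC₁, h₁⟩ := exists_volume_polydisc_le hinj
    (fun i => if i.2 = 0 then (a : ℂ) else 0) (M := 8) (by norm_num) κ
  obtain ⟨C₂, hC₂, h₂⟩ := exists_volume_polydisc_le hinj
    (fun i => if i.2 = 0 then -(a : ℂ) else 0) (M := 8) (by norm_num) κ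
  refine ⟨C₁ + C₂, ENNReal.add_ne_top.2 ⟨hC₁, hC₂⟩, fun δ hδ => ?_⟩
  have e₁ := h₁ δ hδ
  have e₂ := h₂ δ hδ
  rw [hκsum] at e₁ e₂
  rw [add_mul]
  refine le_trans ?_ (add_le_add e₁ e₂)
  refine (measure_mono fun Z hZ => ?_).trans (measure_union_le _ _)
  obtain ⟨hZ, hG⟩ := hZ
  have hz1 : ‖Z ⟨0, 1⟩‖ ^ 2 ≤ 2 * δ := by
    linarith [norm_sq_lt_re_peakTwo hZ, Complex.re_le_norm (peakTwo Z)]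
  have hz0 : ‖Z ⟨0, 0⟩ ^ 2 - (a : ℂ) ^ 2‖ ≤ 2 * δ := by
    have hac : (a : ℂ) ^ 2 = 1 / 2 := by rw [← Complex.ofReal_pow, hasq]; norm_num
    have : Z ⟨0, 0⟩ ^ 2 - (a : ℂ) ^ 2 = -peakTwo Z - Z ⟨0, 1⟩ ^ 2 / 2 := by
      rw [hac, peakTwo]; ring
    rw [this]
    refine (norm_sub_le _ _).trans ?_
    rw [norm_neg, norm_div, norm_pow, Complex.norm_two]
    linarith
  have hsq (x : ℝ) (h0 : 0 ≤ x) (hx : x ≤ 2 * δ / a) : x ^ 2 ≤ 8 * δ ^ 2 := by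
    calc x ^ 2 ≤ (2 * δ / a) ^ 2 := pow_le_pow_left₀ h0 hx 2
      _ = 8 * δ ^ 2 := by rw [div_pow, hasq]; ring
  rcases norm_sub_or_add_le_of_norm_sq_sub_le hapos hz0 with h | h
  · left
    rintro ⟨j, k⟩
    obtain rfl : j = 0 := Subsingleton.elim _ _
    fin_cases k
    · simpa [hκ] using hsq _ (norm_nonneg _) h
    · simp only [hκ]
      simp
      linarith
  · right
    rintro ⟨j, k⟩
    obtain rfl : j = 0 := Subsingleton.elim _ _
    fin_cases k
    · simpa [hκ] using hsq _ (norm_nonneg _) h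
    · simp only [hκ]
      simp
      linarith

lemma isModelPoint_two : IsModelPoint (Omega fun _ : Fin 1 => 2) peakTwo
    (Pi.single ⟨0, 0⟩ (((√2)⁻¹ : ℝ) : ℂ) : Space fun _ : Fin 1 => 2)
    (Pi.single ⟨0, 1⟩ 1 : Space fun _ : Fin 1 => 2) := by
  have ha : (√2)⁻¹ ^ 2 = (1 / 2 : ℝ) := by
    rw [inv_pow, Real.sq_sqrt (by norm_num)]; norm_num
  have ha1 : (√2)⁻¹ ≤ (1 : ℝ) := by
    rw [inv_le_one₀ (by positivity)]
    exact Real.one_le_sqrt.2 (by norm_num)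
  have hapos : (0 : ℝ) < (√2)⁻¹ := by positivity
  generalize (√2)⁻¹ = a at *
  refine isModelPoint_Omega (A := 2) (B := 10) (by norm_num) (by norm_num) (fun t ζ ht => ?_)
    fun t ζ Y ht0 ht hζ hY => ?_
  · rw [sum_gauge_two]
    set z := (1 - t) • (Pi.single ⟨0, 0⟩ (a : ℂ) : Space fun _ : Fin 1 => 2) +
      ζ • (Pi.single ⟨0, 1⟩ 1 : Space fun _ : Fin 1 => 2)
    have z0 : z ⟨0, 0⟩ = (((1 - t) * a : ℝ) : ℂ) := by simp [z]
    have z1 : z ⟨0, 1⟩ = ζ := by simp [z]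
    have h := norm_add_le (z ⟨0, 0⟩ ^ 2) (z ⟨0, 1⟩ ^ 2)
    rw [norm_pow, norm_pow] at h
    have hn : ‖z ⟨0, 0⟩‖ ^ 2 = (1 - t) ^ 2 / 2 := by
      rw [z0, Complex.norm_real, Real.norm_eq_abs, sq_abs, mul_pow, ha]; ring
    rw [z1] at h ⊢
    linarith
  · set z := (1 - t) • (Pi.single ⟨0, 0⟩ (a : ℂ) : Space fun _ : Fin 1 => 2) +
      (Y + ζ • (Pi.single ⟨0, 1⟩ 1 : Space fun _ : Fin 1 => 2))
    have z0 : z ⟨0, 0⟩ = (((1 - t) * a : ℝ) : ℂ) + Y ⟨0, 0⟩ := by simp [z]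
    have z1 : z ⟨0, 1⟩ = Y ⟨0, 1⟩ + ζ := by simp [z]
    set y := Y ⟨0, 0⟩
    set y' := Y ⟨0, 1⟩
    have hy : ‖y‖ ≤ ‖Y‖ := norm_le_pi_norm Y _
    have hy' : ‖y'‖ ≤ ‖Y‖ := norm_le_pi_norm Y _
    have hac : (a : ℂ) ^ 2 = 1 / 2 := by rw [← Complex.ofReal_pow, ha]; norm_num
    have hid : peakTwo z - t = -(((t ^ 2 / 2 : ℝ) : ℂ) + ((2 * ((1 - t) * a) : ℝ) : ℂ) * y + y ^ 2 +
        (y' + ζ) ^ 2 / 2) := by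
      rw [peakTwo, z0, z1]
      push_cast
      linear_combination (-(1 - (t : ℂ)) ^ 2) * hac
    have b1 : ‖((t ^ 2 / 2 : ℝ) : ℂ)‖ = t ^ 2 / 2 := by
      rw [Complex.norm_real, Real.norm_of_nonneg (by positivity)]
    have b2 : ‖((2 * ((1 - t) * a) : ℝ) : ℂ) * y‖ ≤ 2 * ‖Y‖ := by
      rw [norm_mul, Complex.norm_real, Real.norm_of_nonneg (by
        have : 0 ≤ 1 - t := by linarith
        positivity)]
      refine mul_le_mul ?_ hy (norm_nonneg _) (by norm_num)
      nlinarith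
    have b3 : ‖y ^ 2‖ ≤ ‖Y‖ := by
      rw [norm_pow]
      nlinarith [norm_nonneg y, norm_nonneg Y]
    have b4 : ‖(y' + ζ) ^ 2 / 2‖ ≤ ‖Y‖ + ‖ζ‖ ^ 2 := by
      rw [norm_div, norm_pow, Complex.norm_two]
      have := pow_le_pow_left₀ (norm_nonneg _) (norm_add_le y' ζ) 2
      nlinarith [norm_nonneg y', norm_nonneg Y, sq_nonneg (‖y'‖ - ‖ζ‖)]
    rw [hid, norm_neg]
    refine (norm_add_le _ _).trans ?_
    refine (add_le_add_left ((norm_add_le _ _).trans (add_le_add_left (norm_add_le _ _) _)) _).trans ?_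
    rw [b1]
    nlinarith [norm_nonneg Y, sq_nonneg ‖ζ‖, sq_nonneg t]

end BallPair

/-! ### Comparison with the critical exponent and conclusion -/

section Existence

variable {m : ℕ} {N : Fin m → ℕ}

variable (N) in
-- For `N = (2, …, 2)` the right side is `3m + 1`, so the volume bound for `peak N` is better than
-- needed; otherwise both sides agree.
lemma critical_le : critical N ≤ (∑ j, N j) + (m - numOnes N) + 1 := by
  rw [critical]
  split_ifs with h
  · have h1 : numOnes N = 0 := by simp [numOnes, h]
    rw [h1]
    simp [h]
    omega
  · exact le_rfl

lemma exists_volume_peak_le_critical (hm : 0 < m) (hpos : ∀ j, 1 ≤ N j) :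
    ∃ C : ENNReal, C ≠ ⊤ ∧ ∃ δ₀ : ℝ, 0 < δ₀ ∧ ∀ δ : ℝ, 0 < δ → δ ≤ δ₀ →
      volume {Z ∈ Omega N | ‖peak N Z‖ ≤ δ} ≤ C * ENNReal.ofReal (δ ^ critical N) := by
  obtain ⟨C, hC, h⟩ := exists_volume_peak_le hm hpos
  refine ⟨C, hC, min 1 ((√(2 * m))⁻¹ ^ 2 / 4), by positivity, fun δ hδ hle => ?_⟩
  refine (h δ hδ (hle.trans (min_le_right _ _))).trans (mul_le_mul_right ?_ _)
  exact ENNReal.ofReal_le_ofReal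
    (pow_le_pow_of_le_one hδ.le (hle.trans (min_le_left _ _)) (critical_le N))

end Existence

end DbarSharp

theorem theorem1p2 {m : ℕ} (N : Fin m → ℕ) (hpos : ∀ j, 1 ≤ N j) (hN : ∃ j, N j ≠ 1)
    (p : ENNReal) (hp : 2 * (DbarSharp.critical N : ENNReal) < p) :
    ∃ f : (Σ j : Fin m, Fin (N j)) → DbarSharp.Space N → ℂ,
      (∀ i, ContDiffOn ℝ ∞ (f i) (DbarSharp.Omega N)) ∧
      DbarSharp.IsDbarClosed (DbarSharp.Omega N) f ∧
      (p ≠ ⊤ → ∀ s : ENNReal, s < p →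
        ∀ i, MemLp (f i) s (volume.restrict (DbarSharp.Omega N))) ∧
      (p = ⊤ → ∀ i, MemLp (f i) ⊤ (volume.restrict (DbarSharp.Omega N))) ∧
      (∃ u₀ : DbarSharp.Space N → ℂ, ContDiffOn ℝ ∞ u₀ (DbarSharp.Omega N) ∧
        ∀ i, ∀ Z ∈ DbarSharp.Omega N, DbarSharp.dbar i u₀ Z = f i Z) ∧
      ∀ u : DbarSharp.Space N → ℂ, DbarSharp.IsDbarSolution (DbarSharp.Omega N) f u →
        ∀ ε : ℝ, 0 < ε →
          ¬ DbarSharp.MemLipschitz (DbarSharp.Omega N) (DbarSharp.alpha N p + ε) u := by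
  open DbarSharp in
  have hp0 : p ≠ 0 := (zero_le.trans_lt hp).ne'
  obtain ⟨j₀, hj₀⟩ := hN
  have hm : 0 < m := j₀.pos
  obtain ⟨C, hC, δ₀, hδ₀, hvol⟩ := exists_volume_peak_le_critical hm hpos
  by_cases h3 : ∃ j, 3 ≤ N j
  · obtain ⟨j, hj⟩ := h3
    exact exists_sharp_form (isOpen_Omega N) (volume_Omega_lt_top N) contDiff_peak
      (fun Z hZ => re_peak_pos hm hpos hZ) hC hδ₀ hvol
      (isModelPoint_single hm hpos j ⟨2, hj⟩ le_rfl) (i₀ := ⟨j, ⟨2, hj⟩⟩) (by simp) hp0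
  -- Without a block of dimension at least `3`, a tangential direction is obtained by increasing one
  -- isotropic block and decreasing another, which needs `m ≥ 2`; what is left is `N = (2)`.
  by_cases h2 : ∃ j, j ≠ j₀
  · obtain ⟨j, hj⟩ := h2
    refine exists_sharp_form (isOpen_Omega N) (volume_Omega_lt_top N) contDiff_peak
      (fun Z hZ => re_peak_pos hm hpos hZ) hC hδ₀ hvol
      (isModelPoint_isotropic hm hpos (σ := Pi.single j₀ 1 - Pi.single j 1) (by simp))
      (i₀ := ⟨j₀, ⟨0, hpos j₀⟩⟩) ?_ hp0
    simp [isotropic, hj.symm]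
  · push Not at h2 h3
    obtain rfl : m = 1 := by
      by_contra hne
      have a := h2 ⟨0, hm⟩
      have b := h2 ⟨1, by omega⟩
      rw [← b] at a
      simp at a
    obtain rfl : N = fun _ => 2 := by
      ext j
      have a := hpos j
      have b := h3 j
      have c := h2 j
      subst c
      omega
    obtain ⟨C', hC', hvol'⟩ := exists_volume_peakTwo_le
    have hK : critical (fun _ : Fin 1 => 2) = 3 := by simp [critical]
    have := exists_sharp_form (isOpen_Omega _) (volume_Omega_lt_top _) contDiff_peakTwo
      (fun Z hZ => re_peakTwo_pos hZ) hC' one_pos (fun δ h _ => hvol' δ h)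
      isModelPoint_two (i₀ := ⟨0, 1⟩) (by simp) hp0
    rw [alpha, hK]
    exact this
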